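/- Let $T$ be a finite simplicial complex triangulating a closed connected oriented surface of genus $g$, with $N_0$ vertices and $N_1$ edges, and let $a>0$. For a vertex $k$ let $q(k)$ be the number of triangles containing $k$. The 2-cell of the dual polytope $P_T$ around $k$ is a $q(k)$-gon $p(k)$; its sides, labelled consecutively counterclockwise from an arbitrary starting side, are dual to the $q(k)$ edges of $T$ at $k$. Let $(L_j)\in\mathbb{R}_+^{N_1}$ denote the lengths of the edges of $P_T$ (one for each edge of $T$), and let $L_\alpha(k)$, $\alpha=1,\dots,q(k)$, be the length of the $\alpha$-th side of $p(k)$, i.e. the coordinate $L_j$ of the corresponding edge. Put $\eta(k)=\sum_{\alpha=1}^{q(k)}L_\alpha(k)$, $$\varpi(k)=\Big[a\tfrac{\sqrt3}{3}q(k)\Big]^{-2}\sum_{1\le\alpha\le\beta\le q(k)-1}dL_\alpha(k)\wedge dL_\beta(k),\qquad \Omega=\sum_k\Big[\tfrac{\sqrt3}{3}a\,q(k)\Big]^2\varpi(k),$$ and let $$\Delta=\Big\{(L_j)\in\mathbb{R}_+^{N_1}:\ \eta(k)=\tfrac{\sqrt3}{3}a\,q(k)\ \text{for every vertex } k\Big\}.$$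 Then $\Delta$ has dimension $N_1-N_0=2(3g-3+N_0)$. Number the vertices, writing $k_1,\dots,k_{N_0}$. For every numbering of the edges there is a unique form on $\Delta$, denoted $dL_1\wedge\dots\wedge dL_{N_1}|_\Delta$, that is the restriction to $\Delta$ of a form $\omega$ with $d\eta(k_1)\wedge\dots\wedge d\eta(k_{N_0})\wedge\omega=dL_1\wedge\dots\wedge dL_{N_1}$ (all forms having constant coefficients in the $L_j$). Moreover the edges can be numbered, independently of the choice of starting sides, so that on $\Delta$ $$\frac{\Omega^{\,3g-3+N_0}}{(3g-3+N_0)!}=2^{2N_0+5g-5}\,dL_1\wedge dL_2\wedge\dots\wedge dL_{N_1}\big|_\Delta ,$$ and for any other numbering of the edges the same holds up to the sign of the permutation relating the two numberings. -/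

import Mathlib

noncomputable section

namespace Regge

variable {V : Type*} [Fintype V] [DecidableEq V]

/-! ### Triangulated closed oriented surfaces -/

/-- The triangles (two-dimensional faces) of a simplicial complex. -/
def triangles (K : AbstractSimplicialComplex V) : Set (Finset V) :=
  {t | t ∈ K.faces ∧ t.card = 3}

/-- The type of edges (one-dimensional faces) of a simplicial complex. -/
abbrev Edge (K : AbstractSimplicialComplex V) : Type _ :=
  {e : Finset V // e ∈ K.faces ∧ e.card = 2}

instance (K : AbstractSimplicialComplex V) : Fintype (Edge K) := Fintype.ofFinite _

/-- The finite simplicial complex `K` triangulates a closed connected surface: it is purely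
two-dimensional, every edge lies in exactly two triangles, the link of every vertex is connected
(hence a cycle), and `K` is connected and nonempty. -/
structure IsClosedSurface (K : AbstractSimplicialComplex V) : Prop where
  pure : ∀ s ∈ K.faces, ∃ t ∈ triangles K, s ⊆ t
  two_triangles : ∀ e : Edge K, {t ∈ triangles K | e.1 ⊆ t}.ncard = 2
  link_connected : ∀ v a b : V, a ≠ v → b ≠ v → {v, a} ∈ K.faces → {v, b} ∈ K.faces →
    Relation.ReflTransGen (fun x y => {v, x, y} ∈ triangles K) a b
  connected : ∀ u v : V, Relation.ReflTransGen (fun x y => {x, y} ∈ K.faces) u v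
  nonempty : Nonempty V

/-- An orientation of a triangulated surface: `pos a b c` says that `{a, b, c}` is a triangle whose
counterclockwise cyclic order is `(a, b, c)`. Each triangle carries exactly one of its two cyclic
orders, and adjacent triangles are coherently oriented (they induce opposite directions on their
common edge, so that a directed edge occurs in only one positive triangle). -/
structure Orientation (K : AbstractSimplicialComplex V) where
  pos : V → V → V → Prop
  triangle_of_pos : ∀ {a b c}, pos a b c → {a, b, c} ∈ triangles K
  rotate : ∀ {a b c}, pos a b c → pos b c a
  pos_or_pos : ∀ {a b c}, {a, b, c} ∈ triangles K → pos a b c ∨ pos b a c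
  not_pos_swap : ∀ {a b c}, pos a b c → ¬ pos b a c
  coherent : ∀ {a b c d}, pos a b c → pos a b d → c = d

/-- `K` has the Euler characteristic `N₀ - N₁ + N₂ = 2 - 2 g` of a surface of genus `g`. -/
def HasGenus (K : AbstractSimplicialComplex V) (g : ℕ) : Prop :=
  (Fintype.card V : ℤ) - Fintype.card (Edge K) + (triangles K).ncard = 2 - 2 * (g : ℤ)

/-- The curvature assignment `q(k)`: the number of triangles incident on the vertex `k`, i.e. the
number of sides of the polygon dual to `k`. -/
def q (K : AbstractSimplicialComplex V) (k : V) : ℕ := {t ∈ triangles K | k ∈ t}.ncard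

/-- A labelling of the sides of all the dual polygons: `w k 0, w k 1, …` are the neighbours of the
vertex `k`, visited consecutively counterclockwise (the sequence has period `q(k)`; the only
freedom is the choice of the side `w k 0` of the polygon `p(k)` at which the labelling starts). -/
structure SideLabelling {K : AbstractSimplicialComplex V} (o : Orientation K) where
  w : V → ℕ → V
  pos_succ : ∀ k i, o.pos k (w k i) (w k (i + 1))

/-- The `i`-th side of the polygon dual to `k`, as an element of the common set of edges: it is the
polytope edge dual to the edge `{k, w k i}` of the triangulation. -/
def SideLabelling.side {K : AbstractSimplicialComplex V} {o : Orientation K}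
    (w : SideLabelling o) (k : V) (i : ℕ) : Edge K :=
  ⟨{k, w.w k i}, by
    have h := o.triangle_of_pos (w.pos_succ k i)
    have hne : k ≠ w.w k i := by
      intro he
      have h3 := h.2
      rw [← he, Finset.insert_eq_of_mem (Finset.mem_insert_self _ _)] at h3
      have := Finset.card_le_two (a := k) (b := w.w k (i + 1))
      omega
    refine ⟨(K.isRelLowerSet_faces h.1).2 ?_ (Finset.insert_nonempty _ _), Finset.card_pair hne⟩
    intro x hx
    simp only [Finset.mem_insert, Finset.mem_singleton] at hx ⊢
    tauto⟩

/-! ### Differential forms on the space of edge lengths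

The lengths `L` of the edges of the dual polytope are the coordinates of `Edge K → ℝ`. Every form
below has constant coefficients in these coordinates, so it is recorded by its value at a point, an
element of the exterior algebra of the cotangent space; multiplication is the wedge product. -/

/-- The space of (constant coefficient) differential forms on a real vector space `E`. -/
abbrev Form (E : Type*) [AddCommGroup E] [Module ℝ E] : Type _ :=
  ExteriorAlgebra ℝ (Module.Dual ℝ E)

/-- The differential of a linear function. -/
def d {E : Type*} [AddCommGroup E] [Module ℝ E] (f : Module.Dual ℝ E) : Form E :=
  ExteriorAlgebra.ι ℝ f

/-- The restriction of forms to a linear subspace. -/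
def restrict {E : Type*} [AddCommGroup E] [Module ℝ E] (S : Submodule ℝ E) : Form E →ₐ[ℝ] Form S :=
  ExteriorAlgebra.map S.subtype.dualMap

/-- The length `L_j` of the edge `j`, as a coordinate function. -/
def length (K : AbstractSimplicialComplex V) (j : Edge K) : Module.Dual ℝ (Edge K → ℝ) :=
  LinearMap.proj j

/-- The perimeter `η(k) = ∑_j A_{(k)}^j L_j` of the polygon dual to `k`. -/
def perimeter (K : AbstractSimplicialComplex V) (k : V) : Module.Dual ℝ (Edge K → ℝ) :=
  ∑ j : Edge K, (if k ∈ j.1 then (1 : ℝ) else 0) • length K j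

/-- The `2`-form `ϖ(k) = [a (√3/3) q(k)]⁻² ∑_{α ≤ β ≤ q(k) - 1} dL_α(k) ∧ dL_β(k)`
(sides are numbered from `0` here). -/
def varpi {K : AbstractSimplicialComplex V} {o : Orientation K} (a : ℝ) (w : SideLabelling o)
    (k : V) : Form (Edge K → ℝ) :=
  ((a * (√3 / 3) * q K k) ^ 2)⁻¹ •
    ∑ β ∈ Finset.range (q K k - 1), ∑ α ∈ Finset.range (β + 1),
      d (length K (w.side k α)) * d (length K (w.side k β))

/-- The `2`-form `Ω = ∑_k [(√3/3) a q(k)]² ϖ(k)`. -/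
def Omega {K : AbstractSimplicialComplex V} {o : Orientation K} (a : ℝ) (w : SideLabelling o) :
    Form (Edge K → ℝ) :=
  ∑ k : V, ((√3 / 3 * a * q K k) ^ 2) • varpi a w k

/-- The isoperimetric subsimplex `Δ(P_T, {q(k)})`: positive edge lengths for which every polygon
`p(k)` keeps the perimeter `(√3/3) a q(k)` of the equilateral one. -/
def isoperimetricSimplex (K : AbstractSimplicialComplex V) (a : ℝ) : Set (Edge K → ℝ) :=
  {L | (∀ j, 0 < L j) ∧ ∀ k : V, perimeter K k L = √3 / 3 * a * q K k}

/-- The tangent space of the isoperimetric subsimplex (the same at all its points). -/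
def isoTangent (K : AbstractSimplicialComplex V) (a : ℝ) : Submodule ℝ (Edge K → ℝ) :=
  vectorSpan ℝ (isoperimetricSimplex K a)

/-- `dη(k_1) ∧ … ∧ dη(k_{N₀})` for a numbering `κ` of the vertices. -/
def perimeterForm (K : AbstractSimplicialComplex V) (κ : Fin (Fintype.card V) ≃ V) :
    Form (Edge K → ℝ) :=
  (List.ofFn fun i => d (perimeter K (κ i))).prod

/-- The Regge form `dL_1 ∧ … ∧ dL_{N₁}` for a numbering `ε` of the edges. -/
def reggeForm (K : AbstractSimplicialComplex V) (ε : Fin (Fintype.card (Edge K)) ≃ Edge K) :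
    Form (Edge K → ℝ) :=
  (List.ofFn fun i => d (length K (ε i))).prod

/-- `v` is the restriction of the volume form `dL_1 ∧ … ∧ dL_{N₁}` to the isoperimetric subsimplex,
which is cut out by fixing the perimeters `η(k)`: it is the restriction to `Δ` of a form `ω` with
`dη(k_1) ∧ … ∧ dη(k_{N₀}) ∧ ω = dL_1 ∧ … ∧ dL_{N₁}`. -/
def IsReggeRestriction (K : AbstractSimplicialComplex V) (a : ℝ)
    (κ : Fin (Fintype.card V) ≃ V) (ε : Fin (Fintype.card (Edge K)) ≃ Edge K)
    (v : Form (isoTangent K a)) : Prop :=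
  ∃ ω : Form (Edge K → ℝ),
    perimeterForm K κ * ω = reggeForm K ε ∧ restrict (isoTangent K a) ω = v

end Regge

end

noncomputable section

namespace Regge

set_option linter.unusedSectionVars false

open Matrix

/-! ### Pull-back matrices -/

/-! Everything is reduced to linear algebra over the darts (directed edges). Write `t` for the flip,
`r` for the rotation of triangles, `P` for the tails and `I` for the edges, all as pull-back
matrices. The incidence matrix `A = Pᵀ I` has the tangent space of the simplex as its kernel,
because the simplex is a nonempty relatively open piece of an affine subspace.

The key object is the antisymmetric matrix `B = Iᵀ (r² - r) I`, which records the cyclic order of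
edges around triangles. It satisfies `A B = 0`, and summation by parts around each polygon gives
`Ω(B z, x) = 4 z · x` for tangent `x` (`DartMap.bivector_pairing`). So on the tangent space `Ω` is,
up to the factor 4, the inverse of `B`. This makes `Ω` nondegenerate there and independent of the
starting sides.

The constant comes from `|det (B + Aᵀ A)| 2^(N₂+N₀) = 2^N₁ det (A Aᵀ)²`
(`DartMap.abs_det_bivector_add`), where `N₂` is the number of triangles. Sylvester's identity moves
the left-hand determinant to the darts. There, multiplication by `1 + r` turns the matrix into a
low-rank perturbation of `1 - t r`, the difference operator along the rotation about vertices.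

Take a symplectic basis of `Ω` and stack the rows of `A` on those of the dual coframe `C`, extended
by orthogonal projection. The determinant `X` of this square matrix is the ratio of the perimeter
form times the lifted `Ω^k / k!` to the Regge form, where `2k = N₁ - N₀`. Conjugating `B + Aᵀ A` by
the matrix splits it into the blocks `(A Aᵀ)²` and `C B Cᵀ`; the second is 4 times the standard
symplectic matrix. Hence `X² 2^N₁ = 4^(2k) 2^(N₂+N₀)`, and the Euler count gives `|X| =
2^(2N₀+5g-5)`. The sign of `X` is absorbed by the numbering of the edges. Finally, a form on the
tangent space is determined by the product of any lift with the perimeter form. -/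

/-- The matrix of the pull-back of functions along `f`. -/
def pull {X Y : Type*} [DecidableEq Y] (f : X → Y) : Matrix X Y ℝ :=
  Matrix.of fun x y => if f x = y then 1 else 0

section Pull

variable {X Y Z : Type*} [DecidableEq Y] [DecidableEq Z]

theorem pull_apply (f : X → Y) (x : X) (y : Y) : pull f x y = if f x = y then 1 else 0 := rfl

theorem pull_mul_apply {Z : Type*} [Fintype Y] (f : X → Y) (M : Matrix Y Z ℝ) (x : X) (z : Z) :
    (pull f * M) x z = M (f x) z := by
  simp [Matrix.mul_apply, pull_apply]

theorem pull_mul_pull [Fintype Y] (f : X → Y) (g : Y → Z) : pull f * pull g = pull (g ∘ f) := by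
  ext x z
  rw [pull_mul_apply]
  rfl

theorem pull_id : pull (id : Y → Y) = 1 := by
  ext x y
  simp [pull_apply, Matrix.one_apply]

theorem pull_mulVec [Fintype Y] (f : X → Y) (v : Y → ℝ) : pull f *ᵥ v = v ∘ f := by
  ext x
  simp [Matrix.mulVec, dotProduct, pull_apply]

theorem pull_mul_transpose_apply [Fintype Y] (f g : X → Y) (x x' : X) :
    (pull f * (pull g)ᵀ) x x' = if g x' = f x then 1 else 0 := by
  rw [pull_mul_apply, Matrix.transpose_apply, pull_apply]

theorem transpose_pull_equiv [DecidableEq X] (e : X ≃ Y) : (pull e)ᵀ = pull e.symm := by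
  ext y x
  simp only [Matrix.transpose_apply, pull_apply, Equiv.symm_apply_eq]
  simp only [eq_comm]

theorem abs_det_pull_perm [Fintype Y] (e : Equiv.Perm Y) : |(pull e).det| = 1 := by
  have h : pull e * (pull e)ᵀ = 1 := by
    rw [transpose_pull_equiv, pull_mul_pull, ← pull_id]
    congr 1
    ext x
    simp
  have h2 := congrArg Matrix.det h
  rw [Matrix.det_mul, Matrix.det_transpose, Matrix.det_one, ← abs_mul_abs_self] at h2
  nlinarith [abs_nonneg (pull e).det]

end Pull

/-! ### Determinant lemmas -/

/-- The characteristic polynomial is a power of the variable; evaluate it at 1. -/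
theorem det_one_sub_of_isNilpotent {D : Type*} [Fintype D] [DecidableEq D] {N : Matrix D D ℝ}
    (hN : IsNilpotent N) : (1 - N).det = 1 := by
  have h1 : N.charpoly = Polynomial.X ^ Fintype.card D :=
    sub_eq_zero.mp (Matrix.isNilpotent_charpoly_sub_pow_of_isNilpotent hN).eq_zero
  have h2 := Matrix.eval_charpoly N 1
  rw [h1] at h2
  simpa using h2.symm

/-- If `P` and `Q` are right and left annihilators of `M`, with left and right inverses `H₀` and `P₀`, then the determinant of the perturbation
`M + G H` of `M` is multiplicative in the two factors `G` and `H`. -/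
theorem det_add_mul_of_kernel {D V : Type*} [Fintype D] [DecidableEq D] [Fintype V] [DecidableEq V]
    {M : Matrix D D ℝ} {P P₀ G : Matrix D V ℝ} {Q H₀ H : Matrix V D ℝ} (hMP : M * P = 0)
    (hQM : Q * M = 0) (hQP : Q * P₀ = 1) (hHP : H₀ * P = 1) :
    (M + G * H).det = (Q * G).det * (M + P₀ * H₀).det * (H * P).det := by
  -- The left factor replaces `P₀` by `G` and the right factor replaces `H₀` by `H`. By Sylvester's
  -- identity their determinants are those of `Q G` and `H P`.
  have key : M + G * H = (1 + (G - P₀) * Q) * (M + P₀ * H₀) * (1 + P * (H - H₀)) := by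
    have h1 : (1 + (G - P₀) * Q) * (M + P₀ * H₀) = M + G * H₀ := by
      rw [Matrix.add_mul, Matrix.one_mul, Matrix.mul_add, Matrix.mul_assoc _ Q M, hQM,
        Matrix.mul_zero, zero_add, Matrix.mul_assoc _ Q, ← Matrix.mul_assoc Q, hQP, Matrix.one_mul,
        Matrix.sub_mul]
      abel
    rw [h1, Matrix.mul_add, Matrix.mul_one, Matrix.add_mul M, ← Matrix.mul_assoc M, hMP,
      Matrix.zero_mul, zero_add, Matrix.mul_assoc G, ← Matrix.mul_assoc H₀, hHP, Matrix.one_mul,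
      Matrix.mul_sub]
    abel
  rw [key, Matrix.det_mul, Matrix.det_mul, Matrix.det_one_add_mul_comm (G - P₀),
    Matrix.det_one_add_mul_comm P, Matrix.mul_sub Q, hQP, Matrix.sub_mul, hHP, add_sub_cancel,
    add_sub_cancel]

/-! ### Oriented triangulations as combinatorial maps -/

/-- An oriented triangulation described by its directed edges (darts): `flip` reverses a dart and
`next` is the following dart around the triangle on its left. -/
structure DartMap (D V E F : Type*) where
  tail : D → V
  edge : D → E
  tri : D → F
  flip : Equiv.Perm D
  next : Equiv.Perm D
  base : V → D
  flip_ne : ∀ d, flip d ≠ d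
  edge_eq_iff : ∀ d d', edge d' = edge d ↔ d' = d ∨ d' = flip d
  edge_surjective : Function.Surjective edge
  next_ne : ∀ d, next d ≠ d
  next_next_next : ∀ d, next (next (next d)) = d
  tri_eq_iff : ∀ d d', tri d' = tri d ↔ d' = d ∨ d' = next d ∨ d' = next (next d)
  tri_surjective : Function.Surjective tri
  tail_next_flip : ∀ d, tail (next (flip d)) = tail d
  tail_base : ∀ v, tail (base v) = v
  exists_iterate_eq_base : ∀ d, ∃ i : ℕ, (fun x => next (flip x))^[i] d = base (tail d)

namespace DartMap

variable {D V E F : Type*} [Fintype D] [DecidableEq D] [Fintype V] [DecidableEq V]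
  [Fintype E] [DecidableEq E] [Fintype F] [DecidableEq F] (m : DartMap D V E F)

theorem edge_flip (d : D) : m.edge (m.flip d) = m.edge d := (m.edge_eq_iff _ _).2 (Or.inr rfl)

theorem flip_flip (d : D) : m.flip (m.flip d) = d := by
  rcases (m.edge_eq_iff d (m.flip (m.flip d))).1
    (by rw [m.edge_flip, m.edge_flip]) with h | h
  · exact h
  · exact absurd (m.flip.injective h) (m.flip_ne d)

theorem pull_flip_mul_self : pull m.flip * pull m.flip = 1 := by
  rw [pull_mul_pull, ← pull_id]
  congr 1
  ext d
  exact m.flip_flip d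

theorem pull_flip_mul_edge : pull m.flip * pull m.edge = pull m.edge := by
  rw [pull_mul_pull]
  congr 1
  ext d
  exact m.edge_flip d

theorem transpose_pull_flip : (pull m.flip)ᵀ = pull m.flip := by
  rw [transpose_pull_equiv]
  congr 1
  ext d
  rw [Equiv.symm_apply_eq, m.flip_flip]

theorem pull_next_cube : pull m.next * (pull m.next * pull m.next) = 1 := by
  rw [pull_mul_pull, pull_mul_pull, ← pull_id]
  congr 1
  ext d
  exact m.next_next_next d

theorem transpose_pull_next : (pull m.next)ᵀ = pull m.next * pull m.next := by
  rw [transpose_pull_equiv, pull_mul_pull]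
  congr 1
  ext d
  rw [Equiv.symm_apply_eq]
  exact (m.next_next_next d).symm

theorem pull_flip_next_tail :
    pull m.flip * (pull m.next * pull m.tail) = pull m.tail := by
  rw [pull_mul_pull, pull_mul_pull]
  congr 1
  ext d
  exact m.tail_next_flip d

theorem pull_next_tail : pull m.next * pull m.tail = pull m.flip * pull m.tail := by
  have h := congrArg (fun M => pull m.flip * M) m.pull_flip_next_tail
  simpa only [← Matrix.mul_assoc, m.pull_flip_mul_self, Matrix.one_mul] using h

/-- The matrix `t r` is orthogonal and fixes `P`, so its transpose fixes `P` as well. -/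
theorem transpose_tail_flip_next :
    (pull m.tail)ᵀ * (pull m.flip * pull m.next) = (pull m.tail)ᵀ := by
  have h : (pull m.flip * pull m.next) * (pull m.flip * pull m.next)ᵀ = 1 := by
    rw [Matrix.transpose_mul, Matrix.mul_assoc, ← Matrix.mul_assoc (pull m.next),
      transpose_pull_next, pull_next_cube, Matrix.one_mul, transpose_pull_flip, pull_flip_mul_self]
  have h' : (pull m.flip * pull m.next)ᵀ * (pull m.flip * pull m.next) = 1 :=
    mul_eq_one_comm.1 h
  have h2 := congrArg Matrix.transpose m.pull_flip_next_tail
  rw [← Matrix.mul_assoc, Matrix.transpose_mul] at h2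
  conv_lhs => rw [← h2]
  rw [Matrix.mul_assoc, h', Matrix.mul_one]

theorem edge_mul_transpose_edge : pull m.edge * (pull m.edge)ᵀ = 1 + pull m.flip := by
  ext d d'
  rw [pull_mul_transpose_apply, Matrix.add_apply, Matrix.one_apply, pull_apply]
  simp only [m.edge_eq_iff, @eq_comm _ d d', @eq_comm _ _ d']
  have := m.flip_ne d
  by_cases h1 : d' = d
  · subst h1
    simp [this.symm]
  · simp [h1]

theorem transpose_edge_mul_edge : (pull m.edge)ᵀ * pull m.edge = (2 : ℝ) • 1 := by
  ext e e'
  obtain ⟨d, rfl⟩ := m.edge_surjective e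
  have h : ∀ x, (if m.edge x = m.edge d then (1 : ℝ) else 0) =
      (if x = d then 1 else 0) + (if x = m.flip d then 1 else 0) := by
    intro x
    have := m.flip_ne d
    by_cases h1 : x = d
    · subst h1
      simp [this.symm]
    · simp [m.edge_eq_iff, h1]
  simp only [Matrix.mul_apply, Matrix.transpose_apply, pull_apply, h, add_mul, ite_mul, one_mul,
    zero_mul, Finset.sum_add_distrib, Finset.sum_ite_eq', Finset.mem_univ, if_true, m.edge_flip,
    Matrix.smul_apply, Matrix.one_apply, smul_eq_mul]
  split_ifs <;> norm_num

theorem tri_mul_transpose_tri :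
    pull m.tri * (pull m.tri)ᵀ = 1 + pull m.next + pull m.next * pull m.next := by
  ext d d'
  rw [pull_mul_transpose_apply, pull_mul_pull]
  simp only [Matrix.add_apply, Matrix.one_apply, pull_apply, m.tri_eq_iff, @eq_comm _ _ d',
    Function.comp]
  have h1 := m.next_ne d
  have h2 := m.next_ne (m.next d)
  have h3 : m.next (m.next d) ≠ d := fun h => h1 (by
    conv_rhs => rw [← m.next_next_next d, h])
  by_cases e1 : d' = d
  · subst e1
    simp [h1.symm, h3.symm]
  by_cases e2 : d' = m.next d
  · subst e2
    simp [h1, h2.symm]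
  · simp [e1, e2]

theorem transpose_tri_mul_tri : (pull m.tri)ᵀ * pull m.tri = (3 : ℝ) • 1 := by
  ext e e'
  obtain ⟨d, rfl⟩ := m.tri_surjective e
  have h1 := m.next_ne d
  have h2 := m.next_ne (m.next d)
  have h3 : m.next (m.next d) ≠ d := fun h => h1 (by
    conv_rhs => rw [← m.next_next_next d, h])
  have h : ∀ x, (if m.tri x = m.tri d then (1 : ℝ) else 0) =
      (if x = d then 1 else 0) + (if x = m.next d then 1 else 0) +
        (if x = m.next (m.next d) then 1 else 0) := by
    intro x
    by_cases e1 : x = d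
    · subst e1
      simp [h1.symm, h3.symm]
    by_cases e2 : x = m.next d
    · subst e2
      simp [m.tri_eq_iff, h1, h2.symm]
    · simp [m.tri_eq_iff, e1, e2]
  have t1 : m.tri (m.next d) = m.tri d := (m.tri_eq_iff _ _).2 (Or.inr (Or.inl rfl))
  have t2 : m.tri (m.next (m.next d)) = m.tri d := (m.tri_eq_iff _ _).2 (Or.inr (Or.inr rfl))
  simp only [Matrix.mul_apply, Matrix.transpose_apply, pull_apply, h, add_mul, ite_mul, one_mul,
    zero_mul, Finset.sum_add_distrib, Finset.sum_ite_eq', Finset.mem_univ, if_true, t1, t2,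
    Matrix.smul_apply, Matrix.one_apply, smul_eq_mul]
  split_ifs <;> norm_num

theorem card_dart_eq_two_mul (m : DartMap D V E F) : (Fintype.card D : ℝ) = 2 * Fintype.card E := by
  have h := congrArg Matrix.trace m.transpose_edge_mul_edge
  rw [Matrix.trace_mul_comm, m.edge_mul_transpose_edge, Matrix.trace_add, Matrix.trace_smul,
    Matrix.trace_one, Matrix.trace_one] at h
  have h0 : (pull m.flip).trace = 0 := by
    simp [Matrix.trace, pull_apply, m.flip_ne]
  rw [h0, add_zero, smul_eq_mul] at h
  exact h

theorem card_dart_eq_three_mul (m : DartMap D V E F) : (Fintype.card D : ℝ) = 3 * Fintype.card F := by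
  have h := congrArg Matrix.trace m.transpose_tri_mul_tri
  have h3 : ∀ d, m.next (m.next d) ≠ d := fun d h => m.next_ne d (by
    conv_rhs => rw [← m.next_next_next d, h])
  rw [Matrix.trace_mul_comm, m.tri_mul_transpose_tri, Matrix.trace_add, Matrix.trace_add,
    Matrix.trace_smul, Matrix.trace_one, Matrix.trace_one, pull_mul_pull] at h
  have h0 : (pull m.next).trace = 0 := by
    simp [Matrix.trace, pull_apply, m.next_ne]
  have h1 : (pull (m.next ∘ m.next)).trace = 0 := by
    simp [Matrix.trace, pull_apply, h3]
  rw [h0, h1, add_zero, add_zero, smul_eq_mul] at h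
  exact h

/-- Since `r³ = 1`, `r (1 + r)` is `-(1 - T Tᵀ)` with `T` the triangle matrix. Sylvester's identity
and `Tᵀ T = 3` leave a factor `-2` for each triangle. -/
theorem abs_det_one_add_next : |(1 + pull m.next).det| = 2 ^ Fintype.card F := by
  have hK : pull m.next * pull m.tri = pull m.tri := by
    rw [pull_mul_pull]
    congr 1
    ext d
    exact (m.tri_eq_iff _ _).2 (Or.inr (Or.inl rfl))
  have h1 : pull m.next * (1 + pull m.next) = -(1 - pull m.tri * (pull m.tri)ᵀ) := by
    rw [m.tri_mul_transpose_tri, Matrix.mul_add, Matrix.mul_one]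
    abel
  have h2 := congrArg (fun M => |Matrix.det M|) h1
  simp only [Matrix.det_mul, Matrix.det_neg, abs_mul, abs_pow, abs_neg, abs_one, one_pow, one_mul,
    abs_det_pull_perm] at h2
  rw [h2, sub_eq_add_neg, ← Matrix.mul_neg, Matrix.det_one_add_mul_comm, Matrix.neg_mul,
    m.transpose_tri_mul_tri]
  have h3 : (1 + -((3 : ℝ) • (1 : Matrix F F ℝ))) = (-2 : ℝ) • 1 := by
    module
  rw [h3, Matrix.det_smul, Matrix.det_one, mul_one, abs_pow]
  norm_num

/-- Cutting the rotation about the tails at the base darts makes it nilpotent. -/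
theorem det_one_sub_rot_add :
    (1 - pull m.flip * pull m.next +
      (pull m.base)ᵀ * (pull m.base * (pull m.flip * pull m.next))).det = 1 := by
  set r : D → D := fun x => m.next (m.flip x) with hr
  have hS : pull m.flip * pull m.next = pull r := by
    rw [pull_mul_pull]
    rfl
  rw [hS]
  -- The rows of the base darts are set to zero, which cuts the rotation cycle at each vertex.
  set N : Matrix D D ℝ := pull r - (pull m.base)ᵀ * (pull m.base * pull r) with hN
  have hNapp : ∀ d d', N d d' = if d = m.base (m.tail d) then 0 else pull r d d' := by
    intro d d'
    rw [hN, Matrix.sub_apply, Matrix.mul_apply]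
    simp only [Matrix.transpose_apply, pull_mul_apply, pull_apply m.base, ite_mul, one_mul,
      zero_mul]
    have hi : ∀ v, (m.base v = d) ↔ (v = m.tail d ∧ d = m.base (m.tail d)) := by
      intro v
      constructor
      · rintro rfl
        simp [m.tail_base]
      · rintro ⟨rfl, h⟩
        exact h.symm
    by_cases h : d = m.base (m.tail d)
    · rw [if_pos h]
      have : ∀ v, (m.base v = d) ↔ v = m.tail d := fun v => by rw [hi]; simp [← h]
      simp only [this, Finset.sum_ite_eq', Finset.mem_univ, if_true, ← h, sub_self]
    · rw [if_neg h]
      have : ∀ v, (m.base v = d) ↔ False := fun v => by rw [hi]; simp [h]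
      simp [this]
  have hstep : ∀ (k : ℕ) d d', (N ^ (k + 1)) d d' =
      if d = m.base (m.tail d) then 0 else (N ^ k) (r d) d' := by
    intro k d d'
    rw [pow_succ', Matrix.mul_apply]
    simp only [hNapp]
    by_cases h : d = m.base (m.tail d)
    · simp only [if_pos h, zero_mul, Finset.sum_const_zero]
    · simp only [if_neg h, pull_apply, ite_mul, one_mul, zero_mul, Finset.sum_ite_eq,
        Finset.mem_univ, if_true]
  have htail : ∀ d, m.tail (r d) = m.tail d := m.tail_next_flip
  -- A dart that reaches its base after `i` rotations has a zero row in every power of `N` beyond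
  -- the `i`-th.
  have hzero : ∀ (i : ℕ) d, r^[i] d = m.base (m.tail d) → ∀ k, i < k → ∀ d', (N ^ k) d d' = 0 := by
    intro i
    induction i with
    | zero =>
      intro d hd k hk d'
      obtain ⟨k, rfl⟩ := Nat.exists_eq_succ_of_ne_zero hk.ne'
      exact (hstep k d d').trans (if_pos hd)
    | succ i ih =>
      intro d hd k hk d'
      obtain ⟨k, rfl⟩ := Nat.exists_eq_succ_of_ne_zero (by omega : k ≠ 0)
      rw [hstep]
      split_ifs
      · rfl
      · exact ih (r d) (by rw [htail, ← hd, Function.iterate_succ_apply]) k (by omega) d'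
  choose i hi using m.exists_iterate_eq_base
  have hnil : IsNilpotent N := by
    refine ⟨Finset.univ.sup i + 1, ?_⟩
    ext d d'
    exact hzero (i d) d (hi d) _ (Nat.lt_succ_of_le (Finset.le_sup (Finset.mem_univ d))) d'
  rw [← det_one_sub_of_isNilpotent hnil, hN]
  congr 1
  abel

/-! ### The incidence matrix, the cyclic bivector and their determinants. -/

/-- The vertex-edge incidence matrix. -/
def incidence : Matrix V E ℝ := (pull m.tail)ᵀ * pull m.edge

/-- The cyclic bivector: the antisymmetric matrix recording the cyclic order of the edges around
each triangle. -/
def bivector : Matrix E E ℝ :=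
  (pull m.edge)ᵀ * ((pull m.next * pull m.next - pull m.next) * pull m.edge)

theorem transpose_edge_mul_flip : (pull m.edge)ᵀ * pull m.flip = (pull m.edge)ᵀ := by
  have h := congrArg Matrix.transpose m.pull_flip_mul_edge
  rwa [Matrix.transpose_mul, m.transpose_pull_flip] at h

theorem transpose_bivector : m.bivectorᵀ = -m.bivector := by
  rw [bivector, Matrix.transpose_mul, Matrix.transpose_mul, Matrix.transpose_transpose,
    Matrix.transpose_sub, Matrix.transpose_mul, m.transpose_pull_next, Matrix.mul_assoc,
    ← Matrix.mul_neg, ← Matrix.neg_mul, neg_sub]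
  congr 3
  rw [← Matrix.mul_assoc, Matrix.mul_assoc (pull m.next), m.pull_next_cube, Matrix.one_mul]

/-- From `Pᵀ t r = Pᵀ` one gets `Pᵀ t = Pᵀ r²`, hence `Pᵀ (1 + t)(r² - r) = Pᵀ (t - 1)`; and `t - 1`
kills functions of edges. -/
theorem incidence_mul_bivector : m.incidence * m.bivector = 0 := by
  have h1 : (pull m.tail)ᵀ * pull m.flip = (pull m.tail)ᵀ * (pull m.next * pull m.next) := by
    conv_rhs => rw [← m.transpose_tail_flip_next]
    have h := m.pull_next_cube
    rw [Matrix.mul_assoc, Matrix.mul_assoc, h, Matrix.mul_one]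
  have h2 : (pull m.tail)ᵀ * (1 + pull m.flip) * (pull m.next * pull m.next - pull m.next) =
      (pull m.tail)ᵀ * (pull m.flip - 1) := by
    rw [Matrix.mul_add, h1, ← Matrix.mul_add, Matrix.mul_sub _ _ 1, h1, ← Matrix.mul_sub,
      Matrix.mul_assoc]
    congr 1
    have h := m.pull_next_cube
    linear_combination (norm := noncomm_ring) pull m.next * h - h
  rw [incidence, bivector, Matrix.mul_assoc, ← Matrix.mul_assoc (pull m.edge),
    m.edge_mul_transpose_edge, ← Matrix.mul_assoc, ← Matrix.mul_assoc, h2, Matrix.mul_assoc,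
    Matrix.sub_mul, m.pull_flip_mul_edge, Matrix.one_mul, sub_self, Matrix.mul_zero]

theorem incidence_mul_transpose :
    m.incidence * m.incidenceᵀ = (pull m.tail)ᵀ * ((1 + pull m.flip) * pull m.tail) := by
  rw [incidence, Matrix.transpose_mul, Matrix.transpose_transpose, Matrix.mul_assoc,
    ← Matrix.mul_assoc (pull m.edge), m.edge_mul_transpose_edge]

/-- Since `Iᵀ I = 2` and `I Iᵀ = 1 + t`, Sylvester's identity turns the edge determinant into one
over darts. Multiplying by `1 + r`, of determinant `± 2^N₂`, then exposes `1 - t r`, whose left and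
right kernels are explicit. -/
theorem abs_det_bivector_add :
    |(m.bivector + m.incidenceᵀ * m.incidence).det| * 2 ^ (Fintype.card F + Fintype.card V) =
      2 ^ Fintype.card E * (m.incidence * m.incidenceᵀ).det ^ 2 := by
  set r := pull m.next with hr
  set t := pull m.flip with ht
  set I := pull m.edge with hI
  set P := pull m.tail with hP
  set X : Matrix D D ℝ := r * r - r + P * Pᵀ with hX
  have hr3 : r * (r * r) = 1 := m.pull_next_cube
  have e1 : m.bivector + m.incidenceᵀ * m.incidence = Iᵀ * (X * I) := by
    rw [bivector, incidence, hX, Matrix.add_mul, Matrix.mul_add, Matrix.transpose_mul,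
      Matrix.transpose_transpose]
    simp only [Matrix.mul_assoc]
    rfl
  have e2 : (1 + (2⁻¹ : ℝ) • (I * (Iᵀ * (X - 1)))).det =
      (2⁻¹ : ℝ) ^ Fintype.card E * (m.bivector + m.incidenceᵀ * m.incidence).det := by
    rw [← Matrix.mul_smul, Matrix.det_one_add_mul_comm, e1, ← Matrix.det_smul]
    congr 1
    have : Iᵀ * I = (2 : ℝ) • 1 := m.transpose_edge_mul_edge
    rw [Matrix.smul_mul, Matrix.mul_assoc, Matrix.sub_mul, Matrix.one_mul, Matrix.mul_sub, this,
      smul_sub, smul_smul]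
    norm_num
  have e3 : (1 + (2⁻¹ : ℝ) • (I * (Iᵀ * (X - 1)))) * (1 + r) =
      (1 - t * r) + ((2⁻¹ : ℝ) • ((1 + t) * P)) * (Pᵀ * (1 + r)) := by
    rw [← Matrix.mul_assoc I, m.edge_mul_transpose_edge, Matrix.smul_mul, Matrix.mul_assoc (1 + t),
      ← Matrix.mul_assoc P]
    -- Here `(r² - r - 1)(1 + r) = -2 r` because `r³ = 1`; this cancellation is the reason for the
    -- factor `1 + r`.
    have hx : (X - 1) * (1 + r) = P * Pᵀ * (1 + r) - r - r := by
      rw [hX]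
      linear_combination (norm := noncomm_ring) hr3
    rw [Matrix.add_mul, Matrix.smul_mul, Matrix.mul_assoc, hx]
    simp only [Matrix.add_mul, Matrix.mul_add, Matrix.mul_sub, Matrix.one_mul, Matrix.mul_one]
    module
  -- The reference perturbation is the cut rotation, of determinant 1. The remaining two factors are
  -- `A Aᵀ`, one of them halved.
  have e4 := det_add_mul_of_kernel (M := 1 - t * r) (P := P) (P₀ := (pull m.base)ᵀ)
    (G := (2⁻¹ : ℝ) • ((1 + t) * P)) (Q := Pᵀ) (H₀ := pull m.base * (t * r))
    (H := Pᵀ * (1 + r))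
    (by rw [Matrix.sub_mul, Matrix.one_mul, Matrix.mul_assoc, m.pull_flip_next_tail, sub_self])
    (by rw [Matrix.mul_sub, Matrix.mul_one, m.transpose_tail_flip_next, sub_self])
    (by
      rw [← Matrix.transpose_mul, hP, pull_mul_pull,
        show m.tail ∘ m.base = id from funext m.tail_base, pull_id, Matrix.transpose_one])
    (by
      rw [Matrix.mul_assoc, Matrix.mul_assoc, m.pull_flip_next_tail, pull_mul_pull,
        show m.tail ∘ m.base = id from funext m.tail_base, pull_id])
  have e5 : Pᵀ * (1 + r) * P = m.incidence * m.incidenceᵀ := by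
    rw [m.incidence_mul_transpose, Matrix.mul_assoc, Matrix.add_mul, m.pull_next_tail,
      ← Matrix.add_mul]
  have e6 : Pᵀ * ((2⁻¹ : ℝ) • ((1 + t) * P)) = (2⁻¹ : ℝ) • (m.incidence * m.incidenceᵀ) := by
    rw [m.incidence_mul_transpose, Matrix.mul_smul]
  rw [m.det_one_sub_rot_add, e5, e6, Matrix.det_smul, mul_one, ← e3, Matrix.det_mul, e2] at e4
  have e7 := congrArg abs e4
  rw [abs_mul, abs_mul, m.abs_det_one_add_next, mul_assoc _ _ (Matrix.det _), ← sq, abs_mul,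
    abs_pow, abs_pow, abs_of_nonneg (sq_nonneg (m.incidence * m.incidenceᵀ).det)] at e7
  rw [abs_of_pos (by norm_num : (0 : ℝ) < 2⁻¹), inv_pow, inv_pow] at e7
  field_simp at e7
  rw [pow_add]
  linear_combination e7

theorem tail_next (d : D) : m.tail (m.next d) = m.tail (m.flip d) := by
  rw [← m.tail_next_flip (m.flip d), m.flip_flip]

/-- The hypothesis says that `c` changes sign along every edge; a triangle is an odd cycle, so `c`
vanishes on it, and every vertex lies on a triangle. -/
theorem transpose_incidence_mulVec_injective {c : V → ℝ} (h : m.incidenceᵀ *ᵥ c = 0) : c = 0 := by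
  have h1 : ∀ d, c (m.tail d) + c (m.tail (m.flip d)) = 0 := by
    intro d
    have h2 := congrArg (fun v => (pull m.edge *ᵥ v) d) h
    simp only [incidence] at h2
    rw [Matrix.mulVec_mulVec, Matrix.transpose_mul, Matrix.transpose_transpose, ← Matrix.mul_assoc,
      m.edge_mul_transpose_edge, ← Matrix.mulVec_mulVec, pull_mulVec, Matrix.add_mulVec,
      Matrix.one_mulVec, pull_mulVec, Matrix.mulVec_zero] at h2
    exact h2
  ext v
  have h3 := h1 (m.base v)
  have h4 := h1 (m.next (m.base v))
  have h5 := h1 (m.next (m.next (m.base v)))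
  rw [← m.tail_next] at h3 h4 h5
  rw [m.next_next_next] at h5
  rw [m.tail_base] at h3 h5
  simp only [Pi.zero_apply]
  linarith

theorem det_incidence_mul_transpose_ne_zero : (m.incidence * m.incidenceᵀ).det ≠ 0 := by
  intro h
  obtain ⟨c, hc, h0⟩ := Matrix.exists_mulVec_eq_zero_iff.2 h
  apply hc
  apply m.transpose_incidence_mulVec_injective
  rw [← Matrix.mulVec_mulVec] at h0
  have h1 := congrArg (fun v => c ⬝ᵥ v) h0
  simp only [dotProduct_zero] at h1
  rw [Matrix.dotProduct_mulVec, ← Matrix.mulVec_transpose] at h1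
  exact dotProduct_self_eq_zero.1 h1

theorem det_bivector_add_ne_zero : (m.bivector + m.incidenceᵀ * m.incidence).det ≠ 0 := by
  intro h
  have h1 := m.abs_det_bivector_add
  rw [h, abs_zero, zero_mul] at h1
  have h2 := m.det_incidence_mul_transpose_ne_zero
  have : (0 : ℝ) < 2 ^ Fintype.card E * (m.incidence * m.incidenceᵀ).det ^ 2 := by positivity
  linarith

/-- The bivector maps onto the kernel of the incidence matrix. -/
theorem exists_bivector_mulVec {x : E → ℝ} (hx : m.incidence *ᵥ x = 0) :
    ∃ z, m.bivector *ᵥ z = x := by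
  obtain ⟨z, hz⟩ := Matrix.mulVec_surjective_iff_isUnit.2
    ((Matrix.isUnit_iff_isUnit_det _).2 (isUnit_iff_ne_zero.2 m.det_bivector_add_ne_zero)) x
  refine ⟨z, ?_⟩
  rw [Matrix.add_mulVec] at hz
  -- Applying `A` leaves `A Aᵀ (A z) = 0`, so `A z = 0` and the correction term drops out.
  have h1 := congrArg (fun v => m.incidence *ᵥ v) hz
  simp only [Matrix.mulVec_add, Matrix.mulVec_mulVec, m.incidence_mul_bivector, hx,
    Matrix.zero_mulVec, zero_add] at h1
  rw [← Matrix.mul_assoc, ← Matrix.mulVec_mulVec] at h1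
  have h2 := Matrix.eq_zero_of_mulVec_eq_zero m.det_incidence_mul_transpose_ne_zero h1
  rw [← Matrix.mulVec_mulVec, h2, Matrix.mulVec_zero, add_zero] at hz
  exact hz

/-- Primitives along the vertex rotation. -/
theorem exists_primitive {x : E → ℝ} (hx : m.incidence *ᵥ x = 0) :
    ∃ s : D → ℝ, s - (pull m.flip * pull m.next) *ᵥ s = pull m.edge *ᵥ x := by
  have hdet := m.det_one_sub_rot_add
  obtain ⟨s, hs⟩ := Matrix.mulVec_surjective_iff_isUnit.2
    ((Matrix.isUnit_iff_isUnit_det _).2 (by rw [hdet]; exact isUnit_one)) (pull m.edge *ᵥ x)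
  refine ⟨s, ?_⟩
  rw [Matrix.add_mulVec, Matrix.sub_mulVec, Matrix.one_mulVec] at hs
  -- Summing over each star kills both the difference term and the right-hand side, so the
  -- correction at the base darts is zero.
  have h1 := congrArg (fun v => (pull m.tail)ᵀ *ᵥ v) hs
  have h2 : (pull m.tail)ᵀ *ᵥ (pull m.edge *ᵥ x) = 0 := by
    rw [Matrix.mulVec_mulVec]
    exact hx
  have h3 : (pull m.tail)ᵀ * (pull m.base)ᵀ = 1 := by
    rw [← Matrix.transpose_mul, pull_mul_pull,
        show m.tail ∘ m.base = id from funext m.tail_base, pull_id, Matrix.transpose_one]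
  simp only [h2, Matrix.mulVec_add, Matrix.mulVec_sub] at h1
  rw [Matrix.mulVec_mulVec, m.transpose_tail_flip_next, sub_self, zero_add, Matrix.mulVec_mulVec,
    ← Matrix.mul_assoc, h3, Matrix.one_mul] at h1
  rw [← Matrix.mulVec_mulVec s (pull m.base)ᵀ, h1, Matrix.mulVec_zero, add_zero] at hs
  exact hs

/-- Here `s + (t r) s` is the symmetrised primitive produced by summation by parts. After
transposing, only the relations `r³ = 1`, `t² = 1`, `t I = I`, `Iᵀ I = 2` and `(1 - t r) s = I x`
are needed. -/
theorem bivector_dotProduct_primitive {x : E → ℝ} {s : D → ℝ}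
    (hs : s - (pull m.flip * pull m.next) *ᵥ s = pull m.edge *ᵥ x) (z : E → ℝ) :
    (pull m.edge *ᵥ (m.bivector *ᵥ z)) ⬝ᵥ (s + (pull m.flip * pull m.next) *ᵥ s) =
      -4 * (z ⬝ᵥ x) := by
  have hB : (pull m.edge * m.bivector)ᵀ =
      (pull m.edge)ᵀ * ((pull m.next - pull m.next * pull m.next) * (1 + pull m.flip)) := by
    rw [Matrix.transpose_mul, m.transpose_bivector, bivector, ← Matrix.mul_neg, ← Matrix.neg_mul,
      neg_sub, Matrix.mul_assoc, Matrix.mul_assoc, m.edge_mul_transpose_edge]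
  have h0 := m.transpose_edge_mul_edge
  have h1 := m.edge_mul_transpose_edge
  have h2 := m.transpose_edge_mul_flip
  have h3 := m.pull_flip_mul_edge
  set r := pull m.next with hr
  set t := pull m.flip with ht
  set I := pull m.edge with hI
  have hr3 : r * (r * r) = 1 := m.pull_next_cube
  have ht2 : t * t = 1 := m.pull_flip_mul_self
  have hs' : (1 - t * r) *ᵥ s = I *ᵥ x := by
    rw [Matrix.sub_mulVec, Matrix.one_mulVec, hs]
  have hs2 : s + (t * r) *ᵥ s = (1 + t * r) *ᵥ s := by
    rw [Matrix.add_mulVec, Matrix.one_mulVec]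
  -- The last term meets `(1 - t r) s = I x` and dies by `(1 - t) I = 0`. In the first, `Iᵀ (r - 1)
  -- = -Iᵀ (1 - t r)`, and `Iᵀ I = 2` yields `-4 x`.
  have k1 : (r - r * r) * (1 + t) * (1 + t * r) =
      (2 : ℝ) • (r - 1) - (r - r * r) * (1 - t) * (1 - t * r) := by
    linear_combination (norm := (noncomm_ring; try module))
      (2 : ℝ) • ((r - r * r) * ht2 * r) - (2 : ℝ) • hr3
  have k2 : (1 - t) *ᵥ (I *ᵥ x) = 0 := by
    rw [Matrix.mulVec_mulVec, Matrix.sub_mul, Matrix.one_mul, h3, sub_self, Matrix.zero_mulVec]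
  have k3 : Iᵀ * (r - 1) = -(Iᵀ * (1 - t * r)) := by
    rw [Matrix.mul_sub, Matrix.mul_sub, ← Matrix.mul_assoc, h2, neg_sub]
  have k4 : (I * m.bivector)ᵀ *ᵥ ((1 + t * r) *ᵥ s) = (-4 : ℝ) • x := by
    rw [hB, Matrix.mulVec_mulVec, Matrix.mul_assoc, k1, Matrix.mul_sub, Matrix.sub_mulVec,
      Matrix.mul_smul, k3, Matrix.smul_mulVec, Matrix.neg_mulVec, ← Matrix.mulVec_mulVec, hs',
      Matrix.mulVec_mulVec, h0, ← Matrix.mulVec_mulVec, ← Matrix.mulVec_mulVec, hs',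
      ← Matrix.mulVec_mulVec, k2, Matrix.mulVec_zero, Matrix.mulVec_zero, sub_zero,
      Matrix.smul_mulVec, Matrix.one_mulVec]
    module
  rw [hs2, Matrix.mulVec_mulVec, dotProduct_comm, Matrix.dotProduct_mulVec,
    ← Matrix.mulVec_transpose, k4, smul_dotProduct, smul_eq_mul, dotProduct_comm]

end DartMap

/-! ### Exterior algebra -/

section Exterior

open ExteriorAlgebra

variable {M M' : Type*} [AddCommGroup M] [Module ℝ M] [AddCommGroup M'] [Module ℝ M']

/-- Both sides are alternating in the rows of `X`, so they need comparing only on permutations of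
the standard basis; the family `v` need not be independent. -/
theorem _root_.AlternatingMap.map_eq_det_smul {ι : Type*} [Fintype ι] [DecidableEq ι]
    (f : M [⋀^ι]→ₗ[ℝ] M') (u v : ι → M) (X : Matrix ι ι ℝ)
    (h : ∀ i, u i = ∑ j, X i j • v j) : f u = X.det • f v := by
  have key : f.compLinearMap (Fintype.linearCombination ℝ v) =
      (LinearMap.toSpanSingleton ℝ M' (f v)).compAlternatingMap Matrix.detRowAlternating := by
    refine Module.Basis.ext_alternating (Pi.basisFun ℝ ι) fun σ hσ => ?_
    obtain ⟨e, rfl⟩ : ∃ e : Equiv.Perm ι, ⇑e = σ :=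
      ⟨Equiv.ofBijective σ (Finite.injective_iff_bijective.1 hσ), rfl⟩
    have h1 : (fun i => (Fintype.linearCombination ℝ v) (Pi.basisFun ℝ ι (e i))) = v ∘ e := by
      ext i
      simp [Fintype.linearCombination_apply, Pi.single_apply]
    have h2 : (fun i => Pi.basisFun ℝ ι (e i)) = (Pi.basisFun ℝ ι) ∘ e := rfl
    have h3 : Matrix.detRowAlternating (⇑(Pi.basisFun ℝ ι)) = (1 : ℝ) := by
      have : (⇑(Pi.basisFun ℝ ι) : ι → ι → ℝ) = (1 : Matrix ι ι ℝ) := by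
        ext i j
        simp [Matrix.one_apply, Pi.single_apply, eq_comm]
      rw [this]
      exact Matrix.det_one
    rw [AlternatingMap.compLinearMap_apply, LinearMap.compAlternatingMap_apply, h1, h2,
      AlternatingMap.map_perm, AlternatingMap.map_perm, h3]
    simp
  have h4 := congrArg (fun g => g X) key
  have h5 : (fun i => (Fintype.linearCombination ℝ v) (X i)) = u := by
    ext i
    rw [h, Fintype.linearCombination_apply]
  rw [← h5]
  exact h4

theorem ι_mul_ι_swap (a b : M) : ι ℝ a * ι ℝ b = -(ι ℝ b * ι ℝ a) :=
  eq_neg_of_add_eq_zero_left (ι_add_mul_swap a b)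

/-- A one-form can be moved past `y` up to sign, one factor at a time. -/
theorem mul_mul_ι_eq_zero (g : M) (y : ExteriorAlgebra ℝ M) :
    ∀ P : ExteriorAlgebra ℝ M, P * ι ℝ g = 0 → P * (y * ι ℝ g) = 0 := by
  induction y using CliffordAlgebra.left_induction with
  | algebraMap r =>
    intro P hP
    change P * (algebraMap ℝ (ExteriorAlgebra ℝ M) r * ι ℝ g) = 0
    rw [Algebra.commutes, ← mul_assoc, hP, zero_mul]
  | add x y hx hy =>
    intro P hP
    rw [add_mul, mul_add, hx P hP, hy P hP, add_zero]
  | ι_mul x m hx =>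
    intro P hP
    rw [mul_assoc, ← mul_assoc]
    apply hx
    change P * ι ℝ m * ι ℝ g = 0
    rw [mul_assoc, ι_mul_ι_swap, mul_neg, ← mul_assoc, hP, zero_mul, neg_zero]

theorem prod_mul_ι_eq_zero_of_mem {g : M} {l : List M} (hg : g ∈ l) :
    (l.map (ι ℝ)).prod * ι ℝ g = 0 := by
  induction l with
  | nil => simp at hg
  | cons a l ih =>
    rw [List.map_cons, List.prod_cons, mul_assoc]
    rcases List.mem_cons.1 hg with rfl | hg
    · exact mul_mul_ι_eq_zero _ _ _ (ι_sq_zero _)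
    · rw [ih hg, mul_zero]

theorem prod_mul_ι_eq_zero_of_mem_span {g : M} {l : List M} (hg : g ∈ Submodule.span ℝ {x | x ∈ l}) :
    (l.map (ι ℝ)).prod * ι ℝ g = 0 := by
  induction hg using Submodule.span_induction with
  | mem x hx => exact prod_mul_ι_eq_zero_of_mem hx
  | zero => rw [map_zero, mul_zero]
  | add x y _ _ hx hy => rw [map_add, mul_add, hx, hy, add_zero]
  | smul r x _ hx => rw [map_smul, mul_smul_comm, hx, smul_zero]

/-- After multiplication by `P`, a substitution that changes one-forms only by annihilators of `P`
is invisible. -/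
theorem mul_map_eq {P : ExteriorAlgebra ℝ M} {r : M →ₗ[ℝ] M}
    (hP : ∀ x, P * ι ℝ (x - r x) = 0) (ω : ExteriorAlgebra ℝ M) :
    P * ExteriorAlgebra.map r ω = P * ω := by
  induction ω using CliffordAlgebra.right_induction with
  | algebraMap c => rw [show algebraMap ℝ (CliffordAlgebra (0 : QuadraticForm ℝ M)) c =
      algebraMap ℝ (ExteriorAlgebra ℝ M) c from rfl, AlgHom.commutes]
  | add x y hx hy => rw [map_add, mul_add, mul_add, hx, hy]
  | mul_ι m x hx =>
    change P * ExteriorAlgebra.map r (x * ι ℝ m) = P * (x * ι ℝ m)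
    have h := mul_mul_ι_eq_zero _ x _ (hP m)
    rw [map_sub, mul_sub, mul_sub, sub_eq_zero] at h
    rw [map_mul, map_apply_ι, ← mul_assoc, hx, h, mul_assoc]

/-- Contraction of an exterior form. -/
abbrev contract (φ : Module.Dual ℝ M) : ExteriorAlgebra ℝ M →ₗ[ℝ] ExteriorAlgebra ℝ M :=
  CliffordAlgebra.contractLeft (Q := (0 : QuadraticForm ℝ M)) φ

theorem contract_ι_mul (φ : Module.Dual ℝ M) (a : M) (b : ExteriorAlgebra ℝ M) :
    contract φ (ι ℝ a * b) = φ a • b - ι ℝ a * contract φ b :=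
  CliffordAlgebra.contractLeft_ι_mul _ _ _

theorem contract_map_eq_zero (φ : Module.Dual ℝ M) (f : M' →ₗ[ℝ] M) (h : ∀ x, φ (f x) = 0)
    (v : ExteriorAlgebra ℝ M') : contract φ (ExteriorAlgebra.map f v) = 0 := by
  induction v using CliffordAlgebra.left_induction with
  | algebraMap c =>
    rw [show algebraMap ℝ (CliffordAlgebra (0 : QuadraticForm ℝ M')) c =
      algebraMap ℝ (ExteriorAlgebra ℝ M') c from rfl, AlgHom.commutes]
    exact CliffordAlgebra.contractLeft_algebraMap _ _ _
  | add x y hx hy => rw [map_add, map_add, hx, hy, add_zero]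
  | ι_mul x m hx =>
    change contract φ (ExteriorAlgebra.map f (ι ℝ m * x)) = 0
    rw [map_mul, map_apply_ι, contract_ι_mul, hx, h, zero_smul, mul_zero, sub_zero]

theorem contract_prod_mul_eq_zero {I : Type*} (φ : Module.Dual ℝ M) (v : I → M) {l : List I}
    (hl : ∀ a ∈ l, φ (v a) = 0) {z : ExteriorAlgebra ℝ M} (hz : contract φ z = 0) :
    contract φ ((l.map fun i => ι ℝ (v i)).prod * z) = 0 := by
  induction l with
  | nil => simpa using hz
  | cons a l ih =>
    rw [List.map_cons, List.prod_cons, mul_assoc, contract_ι_mul,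
      ih fun b hb => hl b (List.mem_cons_of_mem _ hb), hl a List.mem_cons_self]
    simp

/-- Contraction with the vector dual to the first factor strips off that factor, since it kills the
others and `z`. -/
theorem eq_zero_of_prod_mul_eq_zero {I : Type*} (v : I → M) (φ : I → Module.Dual ℝ M) {l : List I}
    (hl : l.Nodup) (h1 : ∀ a, φ a (v a) = 1) (h0 : ∀ a b, a ≠ b → φ a (v b) = 0)
    {z : ExteriorAlgebra ℝ M} (hz : ∀ a, contract (φ a) z = 0)
    (h : (l.map fun i => ι ℝ (v i)).prod * z = 0) : z = 0 := by
  induction l with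
  | nil => simpa using h
  | cons a l ih =>
    rw [List.nodup_cons] at hl
    refine ih hl.2 ?_
    rw [List.map_cons, List.prod_cons, mul_assoc] at h
    have h2 := congrArg (contract (φ a)) h
    rw [contract_ι_mul, contract_prod_mul_eq_zero _ _ _ (hz a), map_zero,
      mul_zero, sub_zero, h1 a, one_smul] at h2
    · exact h2
    · intro b hb
      exact h0 a b (by rintro rfl; exact hl.1 hb)

theorem add_pow_of_mul_self_eq_zero {A : Type*} [Ring A] {S z : A} (hc : Commute S z)
    (hz : z * z = 0) (m : ℕ) : (S + z) ^ (m + 1) = S ^ (m + 1) + (m + 1 : ℕ) * (S ^ m * z) := by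
  induction m with
  | zero => simp
  | succ m ih =>
    have h1 : S ^ m * z * S = S ^ (m + 1) * z := by
      rw [mul_assoc, ← hc.eq, ← mul_assoc, ← pow_succ]
    rw [pow_succ, ih, add_mul, mul_add, mul_add, mul_assoc _ _ S, h1, mul_assoc _ _ z, mul_assoc _ z,
      hz, mul_zero, mul_zero, ← pow_succ]
    push_cast
    noncomm_ring

/-- The vanishing of the next power is carried along because the induction step for the top power
needs it. -/
theorem sum_pow_of_commute {A : Type*} [Ring A] (d : ℕ) (z : Fin d → A)
    (hc : ∀ i j, Commute (z i) (z j)) (hz : ∀ i, z i * z i = 0) :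
    (∑ i, z i) ^ (d + 1) = 0 ∧ (∑ i, z i) ^ d = (d.factorial : A) * (List.ofFn z).prod := by
  induction d with
  | zero => simp
  | succ d ih =>
    obtain ⟨ih1, ih2⟩ := ih (fun i => z i.succ) (fun i j => hc _ _) (fun i => hz _)
    have hS : Commute (∑ i : Fin d, z i.succ) (z 0) := Commute.sum_left _ _ _ fun i _ => hc _ 0
    rw [Fin.sum_univ_succ, add_comm, add_pow_of_mul_self_eq_zero hS (hz 0),
      add_pow_of_mul_self_eq_zero hS (hz 0), pow_succ _ (d + 1), ih1, (hS.pow_left d).eq, ih2,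
      List.ofFn_succ, List.prod_cons]
    constructor
    · simp
    · rw [Nat.factorial_succ, ← mul_assoc (z 0), (Nat.cast_commute d.factorial (z 0)).eq.symm]
      push_cast
      simp [mul_assoc]

theorem ι_mul_ι_commute (a b c e : M) : Commute (ι ℝ a * ι ℝ b) (ι ℝ c * ι ℝ e) := by
  have h : ∀ x : M, Commute (ι ℝ a * ι ℝ b) (ι ℝ x) := by
    intro x
    rw [Commute, SemiconjBy, mul_assoc, ι_mul_ι_swap b x, mul_neg, ← mul_assoc, ι_mul_ι_swap a x,
      neg_mul, neg_neg, mul_assoc]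
  exact (h c).mul_right (h e)

theorem ι_mul_ι_mul_self (a b : M) : ι ℝ a * ι ℝ b * (ι ℝ a * ι ℝ b) = 0 := by
  rw [mul_assoc, ← mul_assoc (ι ℝ b), ι_mul_ι_swap b a, neg_mul, mul_assoc (ι ℝ a), ι_sq_zero,
    mul_zero, neg_zero, mul_zero]

end Exterior

/-! ### Two-forms and alternating bilinear forms -/

section TwoForm

open ExteriorAlgebra Module

variable {W : Type*} [AddCommGroup W] [Module ℝ W]

/-- The bilinear form of the two-form `f ∧ g`. -/
def wedge (f g : Dual ℝ W) : W →ₗ[ℝ] W →ₗ[ℝ] ℝ := f.smulRight g - g.smulRight f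

theorem wedge_apply (f g : Dual ℝ W) (x y : W) : wedge f g x y = f x * g y - g x * f y := rfl

variable [FiniteDimensional ℝ W]

/-- The two-form of an alternating bilinear form. -/
def twoForm : (W →ₗ[ℝ] W →ₗ[ℝ] ℝ) →ₗ[ℝ] Form W :=
  (2⁻¹ : ℝ) • ∑ i, ∑ j, LinearMap.toSpanSingleton ℝ (Form W)
    (ι ℝ ((finBasis ℝ W).coord i) * ι ℝ ((finBasis ℝ W).coord j)) ∘ₗ
      LinearMap.applyₗ (finBasis ℝ W j) ∘ₗ LinearMap.applyₗ (finBasis ℝ W i)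

/-- Expanding in the basis counts `f ∧ g` twice, once as `-(g ∧ f)`, which the factor one half
corrects. This lets identities of bilinear forms be transported to forms. -/
theorem twoForm_wedge (f g : Dual ℝ W) : twoForm (wedge f g) = ι ℝ f * ι ℝ g := by
  have hf : ∀ f : Dual ℝ W, ι ℝ f =
      ∑ i, f (finBasis ℝ W i) • ι ℝ ((finBasis ℝ W).coord i) := by
    intro f
    conv_lhs => rw [← Basis.sum_dual_apply_smul_coord (finBasis ℝ W) f]
    simp only [map_sum, map_smul]
  have h1 : ∀ f g : Dual ℝ W, ι ℝ f * ι ℝ g = ∑ i, ∑ j, (f (finBasis ℝ W i) * g (finBasis ℝ W j)) •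
      (ι ℝ ((finBasis ℝ W).coord i) * ι ℝ ((finBasis ℝ W).coord j)) := by
    intro f g
    rw [hf f, hf g, Finset.sum_mul_sum]
    simp only [smul_mul_smul_comm]
  have h2 : (2 : ℝ) • twoForm (wedge f g) = ι ℝ f * ι ℝ g - ι ℝ g * ι ℝ f := by
    rw [h1 f g, h1 g f, ← Finset.sum_sub_distrib]
    simp only [← Finset.sum_sub_distrib, ← sub_smul, twoForm, LinearMap.smul_apply, smul_smul]
    norm_num
    simp [wedge_apply]
  rw [ι_mul_ι_swap g f, sub_neg_eq_add, ← two_smul ℝ] at h2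
  exact smul_right_injective _ (two_ne_zero' ℝ) h2

end TwoForm

/-! ### Symplectic bases -/

/-- Split off a hyperbolic plane and induct on its orthogonal complement, which is again
nondegenerate. The expansion of `z` encodes spanning. -/
theorem exists_symplectic_basis (n : ℕ) : ∀ {W : Type*} [AddCommGroup W] [Module ℝ W]
    [FiniteDimensional ℝ W] (_ : Module.finrank ℝ W = n) (b : W →ₗ[ℝ] W →ₗ[ℝ] ℝ)
    (_ : ∀ x, b x x = 0) (_ : ∀ x, (∀ y, b x y = 0) → x = 0),
    ∃ (k : ℕ) (e f : Fin k → W), (∀ i j, b (e i) (f j) = if i = j then 1 else 0) ∧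
      (∀ i j, b (e i) (e j) = 0) ∧ (∀ i j, b (f i) (f j) = 0) ∧
      ∀ z, z = ∑ i, (b (e i) z • f i - b (f i) z • e i) := by
  induction n using Nat.strong_induction_on with
  | _ n ih =>
  intro W _ _ _ hn b halt hnd
  have hskew : ∀ x y, b y x = -b x y := by
    intro x y
    have h := halt (x + y)
    simp only [map_add, LinearMap.add_apply, halt, zero_add, add_zero] at h
    linarith
  by_cases hW : ∀ x : W, x = 0
  · exact ⟨0, Fin.elim0, Fin.elim0, fun i => i.elim0, fun i => i.elim0, fun i => i.elim0,
      fun z => by simpa using hW z⟩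
  push Not at hW
  obtain ⟨x, hx⟩ := hW
  obtain ⟨y, hxy⟩ : ∃ y, b x y = 1 := by
    by_contra! h
    refine hx (hnd x fun y => ?_)
    by_contra h0
    exact h ((b x y)⁻¹ • y) (by simp [h0])
  have hyx : b y x = -1 := by rw [hskew, hxy]
  let W' : Submodule ℝ W := LinearMap.ker (b x) ⊓ LinearMap.ker (b y)
  have hmem : ∀ z, z ∈ W' ↔ b x z = 0 ∧ b y z = 0 := fun z => Iff.rfl
  have hxW : x ∉ W' := fun h => by
    have := ((hmem x).1 h).2
    rw [hyx] at this
    norm_num at this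
  have hlt : Module.finrank ℝ W' < n := by
    rw [← hn]
    exact Submodule.finrank_lt (fun h => hxW (h ▸ Submodule.mem_top))
  have hproj : ∀ z, z - b x z • y + b y z • x ∈ W' := by
    intro z
    rw [hmem]
    simp [halt, hxy, hyx]
  obtain ⟨k, e, f, hef, hee, hff, hz⟩ := ih _ hlt rfl
    ((b.comp W'.subtype).compl₂ W'.subtype) (fun w => halt w) (fun w hw => by
      refine Subtype.ext (hnd w fun z => ?_)
      have h := hw ⟨_, hproj z⟩
      simp only [LinearMap.compl₂_apply, LinearMap.comp_apply, Submodule.subtype_apply, map_add,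
        map_sub, map_smul, hskew y w, hskew x w] at h
      rw [((hmem w).1 w.2).1, ((hmem w).1 w.2).2] at h
      simpa using h)
  simp only [LinearMap.compl₂_apply, LinearMap.comp_apply, Submodule.subtype_apply] at hef hee hff hz
  have hx0 : ∀ w : W', b x w = 0 := fun w => ((hmem w).1 w.2).1
  have hy0 : ∀ w : W', b y w = 0 := fun w => ((hmem w).1 w.2).2
  have hx0' : ∀ w : W', b w x = 0 := fun w => by rw [hskew x, hx0, neg_zero]
  have hy0' : ∀ w : W', b w y = 0 := fun w => by rw [hskew y, hy0, neg_zero]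
  refine ⟨k + 1, Fin.cons x fun i => e i, Fin.cons y fun i => f i, ?_, ?_, ?_, ?_⟩
  · intro i j
    refine Fin.cases ?_ (fun i => ?_) i <;> refine Fin.cases ?_ (fun j => ?_) j
    · simp [hxy]
    · simp [hx0, (Fin.succ_ne_zero j).symm]
    · simp [hy0', Fin.succ_ne_zero i]
    · simp [hef]
  · intro i j
    refine Fin.cases ?_ (fun i => ?_) i <;> refine Fin.cases ?_ (fun j => ?_) j <;>
      simp [halt, hx0, hx0', hee]
  · intro i j
    refine Fin.cases ?_ (fun i => ?_) i <;> refine Fin.cases ?_ (fun j => ?_) j <;>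
      simp [halt, hy0, hy0', hff]
  · intro z
    rw [Fin.sum_univ_succ]
    simp only [Fin.cons_zero, Fin.cons_succ]
    have h := congrArg Subtype.val (hz ⟨_, hproj z⟩)
    simp only [map_add, map_sub, map_smul, hx0', hy0', smul_zero, sub_zero, add_zero,
      AddSubmonoidClass.coe_finsetSum, AddSubgroupClass.coe_sub, Submodule.coe_smul] at h
    rw [← h]
    abel

theorem eq_sum_wedge {W : Type*} [AddCommGroup W] [Module ℝ W] {b : W →ₗ[ℝ] W →ₗ[ℝ] ℝ}
    (hskew : ∀ x y, b y x = -b x y) {k : ℕ} {e f : Fin k → W}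
    (hz : ∀ z, z = ∑ i, (b (e i) z • f i - b (f i) z • e i)) :
    b = ∑ i, wedge (b (e i)) (b (f i)) := by
  ext y z
  conv_lhs => rw [hz z]
  simp only [map_sum, map_sub, map_smul, LinearMap.sum_apply, wedge_apply, smul_eq_mul,
    hskew (e _) y, hskew (f _) y]
  exact Finset.sum_congr rfl fun i _ => by ring

theorem finrank_eq_of_symplectic_basis {W : Type*} [AddCommGroup W] [Module ℝ W]
    {b : W →ₗ[ℝ] W →ₗ[ℝ] ℝ} (hskew : ∀ x y, b y x = -b x y) {k : ℕ} {e f : Fin k → W}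
    (hef : ∀ i j, b (e i) (f j) = if i = j then 1 else 0) (hee : ∀ i j, b (e i) (e j) = 0)
    (hff : ∀ i j, b (f i) (f j) = 0)
    (hz : ∀ z, z = ∑ i, (b (e i) z • f i - b (f i) z • e i)) : Module.finrank ℝ W = k * 2 := by
  let Ψ : W →ₗ[ℝ] (Fin k ⊕ Fin k → ℝ) :=
    LinearMap.pi (Sum.elim (fun i => b (e i)) fun i => b (f i))
  have hinj : Function.Injective Ψ := by
    refine (injective_iff_map_eq_zero Ψ).2 fun z h => ?_
    have h1 : ∀ i, b (e i) z = 0 := fun i => congrFun h (Sum.inl i)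
    have h2 : ∀ i, b (f i) z = 0 := fun i => congrFun h (Sum.inr i)
    rw [hz z]
    simp [h1, h2]
  have hsurj : Function.Surjective Ψ := by
    intro v
    refine ⟨∑ i, (v (Sum.inl i) • f i - v (Sum.inr i) • e i), ?_⟩
    ext s
    rcases s with i | i
    · change b (e i) _ = _
      simp [hef, hee]
    · change b (f i) _ = _
      simp [hff, hskew (e _) (f i), hef]
  rw [(LinearEquiv.ofBijective Ψ ⟨hinj, hsurj⟩).finrank_eq, Module.finrank_pi, Fintype.card_sum,
    Fintype.card_fin, mul_two]

/-! ### Summation by parts around a polygon -/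

/-- Each partial sum of `x` is `S` up to a constant, and the constant pairs to zero with the closed
sequence `y`. The induction keeps the boundary terms, which vanish at `q`. -/
theorem sum_sum_eq_of_primitive {x y S : ℕ → ℝ} (hS : ∀ i, S (i + 1) - S i = x (i + 1)) {q : ℕ}
    (hx : ∑ i ∈ Finset.range q, x i = 0) (hy : ∑ i ∈ Finset.range q, y i = 0) :
    ∑ β ∈ Finset.range (q - 1), ∑ α ∈ Finset.range (β + 1), (y α * x β - x α * y β) =
      -∑ i ∈ Finset.range q, y i * (2 * S i - x i) := by
  have hSX : ∀ i, S i = S 0 - x 0 + ∑ j ∈ Finset.range (i + 1), x j := by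
    intro i
    induction i with
    | zero => simp
    | succ i ih =>
      rw [Finset.sum_range_succ]
      linarith [hS i]
  have hinner : ∀ β, ∑ α ∈ Finset.range (β + 1), (y α * x β - x α * y β) =
      (∑ α ∈ Finset.range (β + 1), y α) * x β - (∑ α ∈ Finset.range (β + 1), x α) * y β := by
    intro β
    rw [Finset.sum_sub_distrib, Finset.sum_mul, Finset.sum_mul]
  have key : ∀ m, ∑ β ∈ Finset.range m, ∑ α ∈ Finset.range (β + 1), (y α * x β - x α * y β) =
      (∑ i ∈ Finset.range m, x i) * (∑ i ∈ Finset.range m, y i) +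
        2 * (S 0 - x 0) * (∑ i ∈ Finset.range m, y i) -
          ∑ i ∈ Finset.range m, y i * (2 * S i - x i) := by
    intro m
    induction m with
    | zero => simp
    | succ m ih =>
      have hm := hSX m
      rw [Finset.sum_range_succ] at hm
      rw [Finset.sum_range_succ, ih, hinner]
      simp only [Finset.sum_range_succ]
      linear_combination (2 * y m) * hm
  cases q with
  | zero => simp
  | succ q =>
    -- The sum over the full range may be used: its last row consists of complete sums of `x` and
    -- `y`, hence is zero.
    have h := key (q + 1)
    rw [hx, hy, Finset.sum_range_succ, hinner, hx, hy] at h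
    rw [Nat.add_sub_cancel]
    linarith

/-! ### Sums over vertex stars and the pairing with the bivector. -/

namespace DartMap

variable {D V E F : Type*} [Fintype D] [DecidableEq D] [Fintype V] [DecidableEq V]
  [Fintype E] [DecidableEq E] [Fintype F] [DecidableEq F] (m : DartMap D V E F)

/-- The rotation of darts about their tail. -/
def rot : Equiv.Perm D := m.flip.trans m.next

theorem rot_apply (d : D) : m.rot d = m.next (m.flip d) := rfl

theorem tail_rot (d : D) : m.tail (m.rot d) = m.tail d := m.tail_next_flip d

/-- The darts with a given tail. -/
def star (v : V) : Finset D := Finset.univ.filter fun d => m.tail d = v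

theorem mem_star {v : V} {d : D} : d ∈ m.star v ↔ m.tail d = v := by simp [star]

theorem sameCycle_rot {d d' : D} (h : m.tail d = m.tail d') : m.rot.SameCycle d d' := by
  have h1 : ∀ d, m.rot.SameCycle d (m.base (m.tail d)) := by
    intro d
    obtain ⟨i, hi⟩ := m.exists_iterate_eq_base d
    exact ⟨i, by rw [zpow_natCast, ← hi, ← Equiv.Perm.iterate_eq_pow]; rfl⟩
  exact (h1 d).trans (h ▸ (h1 d').symm)

/-- The inverse appears because `rot` turns clockwise while sides are labelled counterclockwise. -/
theorem isCycleOn_star (v : V) : m.rot⁻¹.IsCycleOn (m.star v) := by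
  rw [Equiv.Perm.isCycleOn_inv]
  constructor
  · refine ⟨fun d hd => ?_, m.rot.injective.injOn, fun d hd => ⟨m.rot⁻¹ d, ?_, by simp⟩⟩
    · rw [Finset.mem_coe, mem_star] at hd ⊢
      rw [m.tail_rot, hd]
    · rw [Finset.mem_coe, mem_star] at hd ⊢
      rw [← m.tail_rot, Equiv.Perm.inv_def, Equiv.apply_symm_apply, hd]
  · intro d hd d' hd'
    rw [Finset.mem_coe, mem_star] at hd hd'
    exact m.sameCycle_rot (hd.trans hd'.symm)

variable {δ : V → ℕ → D}

theorem sum_range_eq_sum_star (ht : ∀ v i, m.tail (δ v i) = v)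
    (hr : ∀ v i, m.rot (δ v (i + 1)) = δ v i) (G : D → ℝ) (v : V) :
    ∑ i ∈ Finset.range (m.star v).card, G (δ v i) = ∑ d ∈ m.star v, G d := by
  have hδ : ∀ i, δ v i = (m.rot⁻¹ ^ i) (δ v 0) := by
    intro i
    induction i with
    | zero => simp
    | succ i ih =>
      rw [pow_succ', Equiv.Perm.mul_apply, ← ih, ← hr v i, Equiv.Perm.inv_def, Equiv.symm_apply_apply]
  have h0 : δ v 0 ∈ m.star v := m.mem_star.2 (ht v 0)
  refine Finset.sum_bij (fun i _ => δ v i) (fun i _ => m.mem_star.2 (ht v i)) ?_ ?_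
    (fun _ _ => rfl)
  · intro i hi j hj hij
    rw [Finset.mem_range] at hi hj
    rw [hδ i, hδ j, (m.isCycleOn_star v).pow_apply_eq_pow_apply h0] at hij
    rwa [Nat.ModEq, Nat.mod_eq_of_lt hi, Nat.mod_eq_of_lt hj] at hij
  · intro d hd
    obtain ⟨i, hi, h⟩ := (m.isCycleOn_star v).exists_pow_eq h0 hd
    exact ⟨i, Finset.mem_range.2 hi, by rw [hδ, h]⟩

theorem sum_sum_star (G : D → ℝ) : ∑ v, ∑ d ∈ m.star v, G d = ∑ d, G d :=
  Finset.sum_fiberwise (M := ℝ) _ _ _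

theorem incidence_mulVec_apply (x : E → ℝ) (v : V) :
    (m.incidence *ᵥ x) v = ∑ d ∈ m.star v, x (m.edge d) := by
  rw [incidence, ← Matrix.mulVec_mulVec, pull_mulVec, star, Finset.sum_filter]
  simp [Matrix.mulVec, dotProduct, pull_apply]

/-- Closedness of `x` at each vertex provides a primitive `s` on darts. Summation by parts at every
vertex assembles into one sum over darts of `y` against `s + s ∘ rot`, which
`bivector_dotProduct_primitive` evaluates. -/
theorem bivector_pairing (ht : ∀ v i, m.tail (δ v i) = v)
    (hr : ∀ v i, m.rot (δ v (i + 1)) = δ v i) {x y : E → ℝ} (hx : m.incidence *ᵥ x = 0)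
    (z : E → ℝ) (hy : m.bivector *ᵥ z = y) :
    ∑ v, ∑ β ∈ Finset.range ((m.star v).card - 1), ∑ α ∈ Finset.range (β + 1),
      (y (m.edge (δ v α)) * x (m.edge (δ v β)) - x (m.edge (δ v α)) * y (m.edge (δ v β))) =
      4 * (z ⬝ᵥ x) := by
  have hy0 : m.incidence *ᵥ y = 0 := by
    rw [← hy, Matrix.mulVec_mulVec, m.incidence_mul_bivector, Matrix.zero_mulVec]
  have hsum : ∀ {x : E → ℝ}, m.incidence *ᵥ x = 0 → ∀ v,
      ∑ i ∈ Finset.range (m.star v).card, x (m.edge (δ v i)) = 0 := by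
    intro x hx v
    rw [m.sum_range_eq_sum_star ht hr (fun d => x (m.edge d)), ← m.incidence_mulVec_apply, hx]
    rfl
  obtain ⟨s, hs⟩ := m.exists_primitive hx
  have hs' : ∀ d, s d - s (m.rot d) = x (m.edge d) := by
    intro d
    have h := congrFun hs d
    rw [pull_mul_pull, pull_mulVec, pull_mulVec] at h
    exact h
  have h1 : ∀ v, ∑ β ∈ Finset.range ((m.star v).card - 1), ∑ α ∈ Finset.range (β + 1),
      (y (m.edge (δ v α)) * x (m.edge (δ v β)) - x (m.edge (δ v α)) * y (m.edge (δ v β))) =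
      -∑ d ∈ m.star v, y (m.edge d) * (s d + s (m.rot d)) := by
    intro v
    rw [sum_sum_eq_of_primitive (x := fun i => x (m.edge (δ v i)))
      (y := fun i => y (m.edge (δ v i))) (S := fun i => s (δ v i)) _ (hsum hx v) (hsum hy0 v),
      ← m.sum_range_eq_sum_star ht hr]
    · congr 1
      refine Finset.sum_congr rfl fun i _ => ?_
      rw [← hs']
      ring
    · intro i
      rw [← hs', hr]
  rw [Finset.sum_congr rfl fun v _ => h1 v, Finset.sum_neg_distrib, m.sum_sum_star]
  have h2 := m.bivector_dotProduct_primitive hs z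
  rw [hy, pull_mulVec, pull_mul_pull, pull_mulVec] at h2
  simp only [dotProduct, Function.comp, Pi.add_apply] at h2
  simp only [rot_apply, dotProduct]
  linarith

end DartMap

/-! ### The darts of a triangulated surface -/

section Surface

variable {V : Type*} [Fintype V] [DecidableEq V] {K : AbstractSimplicialComplex V}

/-- The directed edges of a simplicial complex. -/
abbrev Dart (K : AbstractSimplicialComplex V) : Type _ :=
  {p : V × V // p.1 ≠ p.2 ∧ {p.1, p.2} ∈ K.faces}

instance : Fintype (Dart K) := Fintype.ofFinite _

instance : Fintype (triangles K) := Fintype.ofFinite _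

theorem exists_eq_of_card_eq_three {t : Finset V} (ht : t.card = 3) {u v : V} (huv : u ≠ v)
    (hu : u ∈ t) (hv : v ∈ t) : ∃ c, t = {u, v, c} := by
  have h1 : ({u, v} : Finset V) ⊆ t := by
    intro x hx
    rcases Finset.mem_insert.1 hx with rfl | hx
    · exact hu
    · rwa [Finset.mem_singleton.1 hx]
  have h2 : (t \ {u, v}).card = 1 := by
    rw [Finset.card_sdiff_of_subset h1, ht, Finset.card_pair huv]
  obtain ⟨c, hc⟩ := Finset.card_eq_one.1 h2
  refine ⟨c, ?_⟩
  rw [← Finset.sdiff_union_of_subset h1, hc]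
  ext x
  simp only [Finset.mem_union, Finset.mem_insert, Finset.mem_singleton]
  tauto

theorem ne_of_mem_triangles {a b c : V} (h : {a, b, c} ∈ triangles K) : a ≠ b ∧ b ≠ c ∧ a ≠ c := by
  have h3 := h.2
  refine ⟨?_, ?_, ?_⟩ <;> rintro rfl
  · rw [Finset.insert_eq_of_mem (Finset.mem_insert_self _ _)] at h3
    have := Finset.card_le_two (a := a) (b := c)
    omega
  · rw [Finset.pair_eq_singleton] at h3
    have := Finset.card_le_two (a := a) (b := b)
    omega
  · rw [Finset.pair_comm b a, Finset.insert_eq_of_mem (Finset.mem_insert_self _ _)] at h3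
    have := Finset.card_le_two (a := a) (b := b)
    omega

theorem pair_mem_faces {a b c : V} (h : {a, b, c} ∈ triangles K) : {a, b} ∈ K.faces := by
  refine (K.isRelLowerSet_faces h.1).2 ?_ (Finset.insert_nonempty _ _)
  intro x hx
  simp only [Finset.mem_insert, Finset.mem_singleton] at hx ⊢
  tauto

namespace Orientation

variable (o : Orientation K)

theorem pos_ne {a b c : V} (h : o.pos a b c) : a ≠ b ∧ b ≠ c ∧ a ≠ c :=
  ne_of_mem_triangles (o.triangle_of_pos h)

/-- If both triangles on the edge were positive for the reversed direction, coherence would give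
them the same third vertex. -/
theorem exists_pos (hK : IsClosedSurface K) {u v : V} (huv : u ≠ v) (he : {u, v} ∈ K.faces) :
    ∃ c, o.pos u v c := by
  have h2 := hK.two_triangles ⟨{u, v}, he, Finset.card_pair huv⟩
  obtain ⟨t, t', hne, hset⟩ := Set.ncard_eq_two.1 h2
  have hmem : ∀ s, s = t ∨ s = t' → s ∈ triangles K ∧ {u, v} ⊆ s := by
    intro s hs
    have : s ∈ ({t, t'} : Set (Finset V)) := hs
    rw [← hset] at this
    exact this
  have hex : ∀ s, s = t ∨ s = t' → ∃ c, s = {u, v, c} ∧ (o.pos u v c ∨ o.pos v u c) := by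
    intro s hs
    obtain ⟨h3, h4⟩ := hmem s hs
    obtain ⟨c, rfl⟩ := exists_eq_of_card_eq_three h3.2 huv (h4 (by simp)) (h4 (by simp))
    exact ⟨c, rfl, o.pos_or_pos h3⟩
  obtain ⟨c, hc, h⟩ := hex t (Or.inl rfl)
  obtain ⟨c', hc', h'⟩ := hex t' (Or.inr rfl)
  rcases h with h | h
  · exact ⟨c, h⟩
  rcases h' with h' | h'
  · exact ⟨c', h'⟩
  · exact absurd (by rw [hc, hc', o.coherent h h']) hne

/-- Two orderings of one triangle differ by a rotation or a transposition, and the latter is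
excluded by `not_pos_swap`. -/
theorem pos_eq_cases {a b c a' b' c' : V} (h : o.pos a b c) (h' : o.pos a' b' c')
    (he : ({a', b', c'} : Finset V) = {a, b, c}) :
    (a' = a ∧ b' = b) ∨ (a' = b ∧ b' = c) ∨ (a' = c ∧ b' = a) := by
  have ha : a' ∈ ({a, b, c} : Finset V) := he ▸ by simp
  have hb : b' ∈ ({a, b, c} : Finset V) := he ▸ by simp
  have hc : c' ∈ ({a, b, c} : Finset V) := he ▸ by simp
  have hn := o.not_pos_swap h
  have hn' := fun h1 => hn (o.rotate h1)
  have hn'' := fun h1 => hn' (o.rotate h1)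
  obtain ⟨n1, n2, n3⟩ := o.pos_ne h'
  simp only [Finset.mem_insert, Finset.mem_singleton] at ha hb hc
  rcases ha with rfl | rfl | rfl <;> rcases hb with rfl | rfl | rfl <;>
    rcases hc with rfl | rfl | rfl <;> first | (exfalso; tauto) | tauto

variable (hK : IsClosedSurface K)

/-- The apex of the triangle on the left of a dart. -/
def apex (d : Dart K) : V := (o.exists_pos hK d.2.1 d.2.2).choose

theorem pos_apex (d : Dart K) : o.pos d.1.1 d.1.2 (o.apex hK d) :=
  (o.exists_pos hK d.2.1 d.2.2).choose_spec

theorem apex_eq {d : Dart K} {c : V} (h : o.pos d.1.1 d.1.2 c) : o.apex hK d = c :=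
  o.coherent (o.pos_apex hK d) h

/-- The dart from `a` to `b` on the boundary of a positive triangle. -/
def dartOfPos {a b c : V} (h : o.pos a b c) : Dart K :=
  ⟨(a, b), (o.pos_ne h).1, pair_mem_faces (o.triangle_of_pos h)⟩

/-- The next dart around the triangle on the left. -/
def nextDart (d : Dart K) : Dart K := o.dartOfPos (o.rotate (o.pos_apex hK d))

theorem nextDart_val (d : Dart K) : (o.nextDart hK d).1 = (d.1.2, o.apex hK d) := rfl

theorem nextDart_dartOfPos {a b c : V} (h : o.pos a b c) :
    o.nextDart hK (o.dartOfPos h) = o.dartOfPos (o.rotate h) := by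
  apply Subtype.ext
  rw [nextDart_val, o.apex_eq hK (d := o.dartOfPos h) h]
  rfl

theorem nextDart_nextDart_nextDart (d : Dart K) :
    o.nextDart hK (o.nextDart hK (o.nextDart hK d)) = d := by
  rw [nextDart.eq_1 o hK d, nextDart_dartOfPos, nextDart_dartOfPos]
  rfl

theorem triangle_apex (d : Dart K) : {d.1.1, d.1.2, o.apex hK d} ∈ triangles K :=
  o.triangle_of_pos (o.pos_apex hK d)

/-- The dart with the opposite direction. -/
def flipDart (d : Dart K) : Dart K :=
  ⟨(d.1.2, d.1.1), d.2.1.symm, by rw [Finset.pair_comm]; exact d.2.2⟩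

/-- The edge underlying a dart. -/
def dartEdge (d : Dart K) : Edge K := ⟨{d.1.1, d.1.2}, d.2.2, Finset.card_pair d.2.1⟩

theorem dartEdge_eq_iff (d d' : Dart K) :
    dartEdge d' = dartEdge d ↔ d' = d ∨ d' = flipDart d := by
  obtain ⟨⟨a, b⟩, h1, h2⟩ := d
  obtain ⟨⟨a', b'⟩, h1', h2'⟩ := d'
  simp only [dartEdge, flipDart, Subtype.mk.injEq, Prod.mk.injEq]
  simp only at h1 h1'
  constructor
  · intro h
    have ha : a' ∈ ({a, b} : Finset V) := h ▸ by simp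
    have hb : b' ∈ ({a, b} : Finset V) := h ▸ by simp
    simp only [Finset.mem_insert, Finset.mem_singleton] at ha hb
    rcases ha with rfl | rfl <;> rcases hb with rfl | rfl <;> simp_all
  · rintro (⟨rfl, rfl⟩ | ⟨rfl, rfl⟩)
    · rfl
    · exact Finset.pair_comm _ _

theorem exists_dart_of_vertex (hK : IsClosedSurface K) (v : V) : ∃ d : Dart K, d.1.1 = v := by
  obtain ⟨t, ht, hv⟩ := hK.pure {v} (K.singleton_mem v)
  have hv : v ∈ t := hv (Finset.mem_singleton_self v)
  obtain ⟨u, hu, huv⟩ := Finset.exists_mem_ne (by rw [ht.2]; norm_num : 1 < t.card) v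
  refine ⟨⟨(v, u), huv.symm, (K.isRelLowerSet_faces ht.1).2 ?_ (Finset.insert_nonempty _ _)⟩, rfl⟩
  intro x hx
  rcases Finset.mem_insert.1 hx with rfl | hx
  · exact hv
  · rwa [Finset.mem_singleton.1 hx]

theorem nextDart_flipDart_val (d : Dart K) :
    (o.nextDart hK (flipDart d)).1.1 = d.1.1 := rfl

theorem nextDart_flipDart_of_pos {v x y : V} (h : o.pos v x y) (hx : v ≠ x ∧ {v, x} ∈ K.faces)
    (hy : v ≠ y ∧ {v, y} ∈ K.faces) :
    o.nextDart hK (flipDart ⟨(v, y), hy⟩) = ⟨(v, x), hx⟩ := by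
  apply Subtype.ext
  rw [nextDart_val, o.apex_eq hK (d := flipDart ⟨(v, y), hy⟩) (o.rotate (o.rotate h))]
  rfl

/-- The rotation of darts about their tail. -/
def rotDart : Equiv.Perm (Dart K) :=
  (⟨flipDart, flipDart, fun _ => rfl, fun _ => rfl⟩ : Equiv.Perm (Dart K)).trans
    ⟨o.nextDart hK, fun d => o.nextDart hK (o.nextDart hK d), o.nextDart_nextDart_nextDart hK,
      o.nextDart_nextDart_nextDart hK⟩

/-- A step in the link of `v` is one rotation about `v`, in one direction or the other, so
connectedness of the link gives a single orbit. -/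
theorem sameCycle_rotDart {v x y : V} (hx : v ≠ x ∧ {v, x} ∈ K.faces)
    (hy : v ≠ y ∧ {v, y} ∈ K.faces) :
    (o.rotDart hK).SameCycle ⟨(v, x), hx⟩ ⟨(v, y), hy⟩ := by
  have h := hK.link_connected v x y hx.1.symm hy.1.symm hx.2 hy.2
  induction h with
  | refl => exact Equiv.Perm.SameCycle.refl _ _
  | tail _ hstep ih =>
    rename_i b c _
    have hb : v ≠ b ∧ {v, b} ∈ K.faces := ⟨(ne_of_mem_triangles hstep).1, pair_mem_faces hstep⟩
    refine (ih hb).trans ?_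
    rcases o.pos_or_pos hstep with h | h
    · exact Equiv.Perm.SameCycle.symm ⟨1, o.nextDart_flipDart_of_pos hK h hb hy⟩
    · exact ⟨1, o.nextDart_flipDart_of_pos hK (o.rotate h) hy hb⟩

/-- The combinatorial map of an oriented triangulated surface. -/
def dartMap : DartMap (Dart K) V (Edge K) (triangles K) where
  tail d := d.1.1
  edge := dartEdge
  tri d := ⟨{d.1.1, d.1.2, o.apex hK d}, o.triangle_apex hK d⟩
  flip := ⟨flipDart, flipDart, fun _ => rfl, fun _ => rfl⟩
  next := ⟨o.nextDart hK, fun d => o.nextDart hK (o.nextDart hK d),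
    o.nextDart_nextDart_nextDart hK, o.nextDart_nextDart_nextDart hK⟩
  base v := (exists_dart_of_vertex hK v).choose
  flip_ne d h := d.2.1 (congrArg (fun d => d.1.2) h)
  edge_eq_iff := dartEdge_eq_iff
  edge_surjective e := by
    obtain ⟨e, he, he2⟩ := e
    obtain ⟨a, b, hab, rfl⟩ := Finset.card_eq_two.1 he2
    exact ⟨⟨(a, b), hab, he⟩, rfl⟩
  next_ne d h := d.2.1 (congrArg (fun d => d.1.1) h).symm
  next_next_next := o.nextDart_nextDart_nextDart hK
  tri_eq_iff d d' := by
    have hp := o.pos_apex hK d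
    have hp' := o.pos_apex hK d'
    rw [Subtype.mk.injEq]
    constructor
    · intro h
      rcases o.pos_eq_cases hp hp' h with h | h | h
      · exact Or.inl (Subtype.ext (Prod.ext h.1 h.2))
      · exact Or.inr (Or.inl (Subtype.ext (Prod.ext h.1 h.2)))
      · refine Or.inr (Or.inr (Subtype.ext (Prod.ext h.1 ?_)))
        rw [h.2]
        exact (o.apex_eq hK (d := o.nextDart hK d) (o.rotate hp)).symm
    · have h1 : ∀ d : Dart K, ({(o.nextDart hK d).1.1, (o.nextDart hK d).1.2,
          o.apex hK (o.nextDart hK d)} : Finset V) = {d.1.1, d.1.2, o.apex hK d} := by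
        intro d
        rw [o.apex_eq hK (d := o.nextDart hK d) (o.rotate (o.pos_apex hK d)), nextDart_val]
        ext x
        simp only [Finset.mem_insert, Finset.mem_singleton]
        tauto
      rintro (rfl | rfl | rfl)
      · rfl
      · exact h1 d
      · exact (h1 _).trans (h1 d)
  tri_surjective t := by
    obtain ⟨t, ht⟩ := t
    obtain ⟨a, b, c, -, -, -, rfl⟩ := Finset.card_eq_three.1 ht.2
    rcases o.pos_or_pos ht with h | h
    · refine ⟨o.dartOfPos h, Subtype.ext ?_⟩
      change ({a, b, o.apex hK (o.dartOfPos h)} : Finset V) = _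
      rw [o.apex_eq hK (d := o.dartOfPos h) h]
    · refine ⟨o.dartOfPos h, Subtype.ext ?_⟩
      change ({b, a, o.apex hK (o.dartOfPos h)} : Finset V) = _
      rw [o.apex_eq hK (d := o.dartOfPos h) h, Finset.insert_comm]
  tail_next_flip := o.nextDart_flipDart_val hK
  tail_base v := (exists_dart_of_vertex hK v).choose_spec
  exists_iterate_eq_base d := by
    have hspec := (exists_dart_of_vertex hK d.1.1).choose_spec
    have h : (o.rotDart hK).SameCycle d (exists_dart_of_vertex hK d.1.1).choose := by
      generalize (exists_dart_of_vertex hK d.1.1).choose = b at hspec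
      obtain ⟨⟨v, x⟩, hx⟩ := d
      obtain ⟨⟨v', y⟩, hy⟩ := b
      obtain rfl : v' = v := hspec
      exact o.sameCycle_rotDart hK hx hy
    obtain ⟨i, -, hi⟩ := h.exists_pow_eq'
    refine ⟨i, ?_⟩
    rw [← hi, ← Equiv.Perm.iterate_eq_pow]
    rfl

/-- A dart at `v` corresponds to the triangle on its left; conversely exactly one of the three
boundary darts of a triangle starts at a given vertex of it. -/
theorem card_star (v : V) : ((o.dartMap hK).star v).card = q K v := by
  rw [q, ← Set.ncard_coe_finset]
  refine Set.ncard_congr (fun d _ => ({d.1.1, d.1.2, o.apex hK d} : Finset V)) ?_ ?_ ?_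
  · intro d hd
    rw [Finset.mem_coe, DartMap.mem_star] at hd
    exact ⟨o.triangle_apex hK d, hd ▸ by simp [dartMap]⟩
  · intro d d' hd hd' h
    rw [Finset.mem_coe, DartMap.mem_star] at hd hd'
    have hd : d.1.1 = v := hd
    have hd' : d'.1.1 = v := hd'
    have hp := o.pos_apex hK d
    rcases o.pos_eq_cases (o.pos_apex hK d') hp h with h | h | h
    · exact Subtype.ext (Prod.ext h.1 h.2)
    · exact absurd (hd'.trans (hd.symm.trans h.1)) (o.pos_ne (o.pos_apex hK d')).1
    · exact absurd (hd'.trans (hd.symm.trans h.1)) (o.pos_ne (o.pos_apex hK d')).2.2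
  · rintro t ⟨ht, hv⟩
    obtain ⟨u, hu, huv⟩ := Finset.exists_mem_ne (by rw [ht.2]; norm_num : 1 < t.card) v
    obtain ⟨c, rfl⟩ := exists_eq_of_card_eq_three ht.2 huv.symm hv hu
    rcases o.pos_or_pos ht with h | h
    · refine ⟨o.dartOfPos h, (DartMap.mem_star _).2 rfl, ?_⟩
      change ({v, u, o.apex hK (o.dartOfPos h)} : Finset V) = _
      rw [o.apex_eq hK (d := o.dartOfPos h) h]
    · refine ⟨o.dartOfPos (o.rotate h), (DartMap.mem_star _).2 rfl, ?_⟩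
      change ({v, c, o.apex hK (o.dartOfPos (o.rotate h))} : Finset V) = _
      rw [o.apex_eq hK (d := o.dartOfPos (o.rotate h)) (o.rotate h), Finset.pair_comm]

theorem q_pos (o : Orientation K) (hK : IsClosedSurface K) (v : V) : 0 < q K v := by
  rw [← o.card_star hK, Finset.card_pos]
  exact ⟨_, (DartMap.mem_star _).2 ((o.dartMap hK).tail_base v)⟩

theorem incidence_apply (v : V) (e : Edge K) :
    (o.dartMap hK).incidence v e = if v ∈ e.1 then 1 else 0 := by
  obtain ⟨d, rfl⟩ := (o.dartMap hK).edge_surjective e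
  have h := (o.dartMap hK).incidence_mulVec_apply (Pi.single ((o.dartMap hK).edge d) 1) v
  rw [Matrix.mulVec_single_one, Matrix.col_apply] at h
  rw [h]
  have hiff : ∀ x : Dart K, (o.dartMap hK).edge x = (o.dartMap hK).edge d ↔
      x = d ∨ x = flipDart d := fun x => (o.dartMap hK).edge_eq_iff d x
  have hne : flipDart d ≠ d := (o.dartMap hK).flip_ne d
  have h1 : ∀ x : Dart K, (Pi.single ((o.dartMap hK).edge d) (1 : ℝ) : Edge K → ℝ)
      ((o.dartMap hK).edge x) = (if x = d then 1 else 0) + (if x = flipDart d then 1 else 0) := by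
    intro x
    simp only [Pi.single_apply, hiff]
    by_cases h1 : x = d
    · subst h1
      simp [hne.symm]
    · simp [h1]
  rw [Finset.sum_congr rfl fun x _ => h1 x, Finset.sum_add_distrib, Finset.sum_ite_eq',
    Finset.sum_ite_eq']
  simp only [DartMap.mem_star]
  change (if d.1.1 = v then (1 : ℝ) else 0) + (if d.1.2 = v then 1 else 0) =
    if v ∈ ({d.1.1, d.1.2} : Finset V) then 1 else 0
  have := d.2.1
  by_cases e1 : d.1.1 = v
  · have e2 : d.1.2 ≠ v := fun h => this (e1.trans h.symm)
    simp [e1, e2]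
  · simp [e1, Ne.symm e1, @eq_comm _ v]

end Orientation

end Surface

variable {V : Type*} [Fintype V] [DecidableEq V] {K : AbstractSimplicialComplex V}

namespace Orientation

variable (o : Orientation K) (hK : IsClosedSurface K)

/-! ### The isoperimetric tangent space -/

theorem perimeter_apply (k : V) (x : Edge K → ℝ) :
    perimeter K k x = ((o.dartMap hK).incidence *ᵥ x) k := by
  simp only [perimeter, length, Matrix.mulVec, dotProduct, o.incidence_apply hK,
    LinearMap.sum_apply, LinearMap.smul_apply, LinearMap.proj_apply, smul_eq_mul]

theorem perimeter_const (o : Orientation K) (hK : IsClosedSurface K) (c : ℝ) (k : V) : perimeter K k (fun _ => c) = c * q K k := by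
  rw [o.perimeter_apply hK, DartMap.incidence_mulVec_apply, Finset.sum_const, o.card_star hK,
    nsmul_eq_mul, mul_comm]

/-- The equilateral point, with all lengths equal to `√3 / 3 * a`, is interior to the positive
orthant. A small multiple of any perimeter-preserving direction can therefore be added to it. -/
theorem mem_isoTangent_iff (o : Orientation K) (hK : IsClosedSurface K) {a : ℝ} (ha : 0 < a) (x : Edge K → ℝ) :
    x ∈ isoTangent K a ↔ ∀ k, perimeter K k x = 0 := by
  constructor
  · intro h k
    have hle : isoTangent K a ≤ LinearMap.ker (perimeter K k) := by
      rw [isoTangent, vectorSpan_def, Submodule.span_le]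
      rintro _ ⟨L, hL, L', hL', rfl⟩
      have h1 := hL.2 k
      have h2 := hL'.2 k
      simp only [vsub_eq_sub, SetLike.mem_coe, LinearMap.mem_ker, map_sub, h1, h2, sub_self]
    exact hle h
  · intro h
    set c : ℝ := √3 / 3 * a with hc
    have hc0 : 0 < c := by positivity
    have hb : ∃ t : ℝ, 0 < t ∧ ∀ j, 0 < c + t * x j := by
      obtain ⟨M, hM⟩ : ∃ M : ℝ, ∀ j, |x j| ≤ M := by
        obtain ⟨M, hM⟩ := (Set.finite_range fun j => |x j|).bddAbove
        exact ⟨M, fun j => hM ⟨j, rfl⟩⟩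
      refine ⟨c / (|M| + 1), by positivity, fun j => ?_⟩
      have h1 : -(|M| + 1) < x j := by
        have := hM j
        have := neg_abs_le (x j)
        have := le_abs_self M
        linarith
      have h2 : c / (|M| + 1) * -(|M| + 1) < c / (|M| + 1) * x j :=
        mul_lt_mul_of_pos_left h1 (by positivity)
      have h3 : c / (|M| + 1) * -(|M| + 1) = -c := by
        field_simp
      linarith
    obtain ⟨t, ht, htx⟩ := hb
    have h0 : (fun _ => c) ∈ isoperimetricSimplex K a :=
      ⟨fun _ => hc0, fun k => by rw [o.perimeter_const hK, hc]⟩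
    have h1 : (fun _ => c) + t • x ∈ isoperimetricSimplex K a := by
      refine ⟨htx, fun k => ?_⟩
      rw [map_add, map_smul, h k, smul_zero, add_zero, o.perimeter_const hK, hc]
    have h2 := vsub_mem_vectorSpan ℝ h1 h0
    rw [vsub_eq_sub, add_sub_cancel_left] at h2
    have h3 := Submodule.smul_mem _ t⁻¹ h2
    rwa [smul_smul, inv_mul_cancel₀ ht.ne', one_smul] at h3

theorem mem_isoTangent_iff_incidence {a : ℝ} (ha : 0 < a) (x : Edge K → ℝ) :
    x ∈ isoTangent K a ↔ (o.dartMap hK).incidence *ᵥ x = 0 := by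
  rw [o.mem_isoTangent_iff hK ha, funext_iff]
  exact forall_congr' fun k => by rw [o.perimeter_apply hK]; rfl

/-- The vectors orthogonal to the isoperimetric tangent space and dual to the perimeters. -/
def dualMatrix : Matrix (Edge K) V ℝ :=
  (o.dartMap hK).incidenceᵀ * ((o.dartMap hK).incidence * (o.dartMap hK).incidenceᵀ)⁻¹

theorem incidence_mul_dualMatrix : (o.dartMap hK).incidence * o.dualMatrix hK = 1 := by
  rw [dualMatrix, ← Matrix.mul_assoc, Matrix.mul_nonsing_inv]
  exact isUnit_iff_ne_zero.2 (o.dartMap hK).det_incidence_mul_transpose_ne_zero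

theorem dualMatrix_mul_mul :
    o.dualMatrix hK * ((o.dartMap hK).incidence * (o.dartMap hK).incidenceᵀ) =
      (o.dartMap hK).incidenceᵀ := by
  rw [dualMatrix, Matrix.mul_assoc, Matrix.nonsing_inv_mul, Matrix.mul_one]
  exact isUnit_iff_ne_zero.2 (o.dartMap hK).det_incidence_mul_transpose_ne_zero

variable {a : ℝ} (ha : 0 < a)

/-- The orthogonal projection onto the isoperimetric tangent space. -/
def isoProj : (Edge K → ℝ) →ₗ[ℝ] isoTangent K a :=
  LinearMap.codRestrict _
    (LinearMap.id - (o.dualMatrix hK * (o.dartMap hK).incidence).mulVecLin) fun x => by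
      rw [o.mem_isoTangent_iff_incidence hK ha, LinearMap.sub_apply, Matrix.mulVecLin_apply,
        Matrix.mulVec_sub, Matrix.mulVec_mulVec, ← Matrix.mul_assoc, o.incidence_mul_dualMatrix hK,
        Matrix.one_mul, LinearMap.id_apply, sub_self]

theorem coe_isoProj (x : Edge K → ℝ) : (o.isoProj hK ha x : Edge K → ℝ) =
    x - o.dualMatrix hK *ᵥ ((o.dartMap hK).incidence *ᵥ x) := by
  rw [Matrix.mulVec_mulVec]
  rfl

theorem isoProj_coe (x : isoTangent K a) : o.isoProj hK ha x = x := by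
  apply Subtype.ext
  rw [coe_isoProj, (o.mem_isoTangent_iff_incidence hK ha _).1 x.2, Matrix.mulVec_zero, sub_zero]

theorem isoProj_dualMatrix (c : V → ℝ) : o.isoProj hK ha (o.dualMatrix hK *ᵥ c) = 0 := by
  apply Subtype.ext
  rw [coe_isoProj, Matrix.mulVec_mulVec c, o.incidence_mul_dualMatrix hK, Matrix.one_mulVec, sub_self]
  rfl

/-- Orthogonality of the projection, which later removes the off-diagonal blocks. -/
theorem isoProj_transpose (c : V → ℝ) :
    o.isoProj hK ha ((o.dartMap hK).incidenceᵀ *ᵥ c) = 0 := by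
  rw [← o.dualMatrix_mul_mul hK, ← Matrix.mulVec_mulVec, isoProj_dualMatrix]

theorem finrank_isoTangent_add (o : Orientation K) (hK : IsClosedSurface K) (ha : 0 < a) :
    Module.finrank ℝ (isoTangent K a) + Fintype.card V = Fintype.card (Edge K) := by
  have h1 := LinearMap.finrank_range_add_finrank_ker (o.dartMap hK).incidence.mulVecLin
  have h2 : LinearMap.range (o.dartMap hK).incidence.mulVecLin = ⊤ := by
    rw [LinearMap.range_eq_top]
    intro c
    refine ⟨o.dualMatrix hK *ᵥ c, ?_⟩
    rw [Matrix.mulVecLin_apply, Matrix.mulVec_mulVec, o.incidence_mul_dualMatrix hK,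
      Matrix.one_mulVec]
  have h3 : LinearMap.ker (o.dartMap hK).incidence.mulVecLin = isoTangent K a := by
    ext x
    rw [LinearMap.mem_ker, Matrix.mulVecLin_apply, o.mem_isoTangent_iff_incidence hK ha]
  rw [h2, h3, finrank_top, Module.finrank_pi, Module.finrank_pi] at h1
  omega

/-! ### Restriction of forms -/

theorem restrict_d {E : Type*} [AddCommGroup E] [Module ℝ E] (S : Submodule ℝ E)
    (f : Module.Dual ℝ E) : restrict S (d f) = d (S.subtype.dualMap f) :=
  ExteriorAlgebra.map_apply_ι _ _

theorem restrict_comp_isoProj (v : Form (isoTangent K a)) :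
    restrict (isoTangent K a) (ExteriorAlgebra.map (o.isoProj hK ha).dualMap v) = v := by
  have h : (isoTangent K a).subtype.dualMap ∘ₗ (o.isoProj hK ha).dualMap = LinearMap.id := by
    ext f x
    exact congrArg f (o.isoProj_coe hK ha x)
  rw [restrict, ← AlgHom.comp_apply, ExteriorAlgebra.map_comp_map, h, ExteriorAlgebra.map_id]
  rfl

theorem perimeterForm_eq (κ : Fin (Fintype.card V) ≃ V) : perimeterForm K κ =
    ((List.ofFn κ).map fun k => ExteriorAlgebra.ι ℝ (perimeter K k)).prod := by
  rw [List.map_ofFn]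
  rfl

/-- The projection removes `dualMatrix` times the vector of perimeters, so the difference is a
combination of perimeters. -/
theorem sub_isoProj_mem_span (f : Module.Dual ℝ (Edge K → ℝ)) :
    f - ((o.isoProj hK ha).dualMap ∘ₗ (isoTangent K a).subtype.dualMap) f ∈
      Submodule.span ℝ (Set.range (perimeter K)) := by
  have h : f - ((o.isoProj hK ha).dualMap ∘ₗ (isoTangent K a).subtype.dualMap) f =
      ∑ k, f (o.dualMatrix hK *ᵥ Pi.single k 1) • perimeter K k := by
    refine LinearMap.ext fun x => ?_
    change f x - f (o.isoProj hK ha x : Edge K → ℝ) = _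
    have h1 : (o.dartMap hK).incidence *ᵥ x =
        ∑ k, perimeter K k x • (Pi.single k (1 : ℝ) : V → ℝ) := by
      ext k
      rw [← o.perimeter_apply hK]
      simp [Finset.sum_apply, Pi.single_apply]
    rw [coe_isoProj, map_sub, sub_sub_cancel, h1, Matrix.mulVec_sum, map_sum, LinearMap.sum_apply]
    refine Finset.sum_congr rfl fun k _ => ?_
    rw [Matrix.mulVec_smul, map_smul, LinearMap.smul_apply, smul_eq_mul, smul_eq_mul, mul_comm]
  rw [h]
  exact Submodule.sum_mem _ fun k _ => Submodule.smul_mem _ _ (Submodule.subset_span ⟨k, rfl⟩)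

theorem perimeterForm_mul_map (κ : Fin (Fintype.card V) ≃ V) (ω : Form (Edge K → ℝ)) :
    perimeterForm K κ * ExteriorAlgebra.map (o.isoProj hK ha).dualMap
      (restrict (isoTangent K a) ω) = perimeterForm K κ * ω := by
  rw [restrict, ← AlgHom.comp_apply, ExteriorAlgebra.map_comp_map]
  refine mul_map_eq (fun x => ?_) ω
  have h1 : perimeterForm K κ =
      (((List.ofFn κ).map (perimeter K)).map (ExteriorAlgebra.ι ℝ)).prod := by
    rw [perimeterForm_eq, List.map_map]
    rfl
  rw [h1]
  refine prod_mul_ι_eq_zero_of_mem_span ?_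
  have h2 : {x | x ∈ (List.ofFn κ).map (perimeter K)} = Set.range (perimeter K) := by
    ext f
    simp only [List.mem_map, Set.mem_ofPred_eq, Set.mem_range, List.mem_ofFn]
    constructor
    · rintro ⟨k, -, h⟩
      exact ⟨k, h⟩
    · rintro ⟨k, h⟩
      exact ⟨k, ⟨κ.symm k, by simp⟩, h⟩
  rw [h2]
  exact o.sub_isoProj_mem_span hK ha x

/-- The restriction to the isoperimetric simplex is determined by the product with the perimeter
form. -/
theorem restrict_eq_of_perimeterForm_mul_eq (o : Orientation K) (hK : IsClosedSurface K)
    (ha : 0 < a) (κ : Fin (Fintype.card V) ≃ V) {ω ω' : Form (Edge K → ℝ)}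
    (h : perimeterForm K κ * ω = perimeterForm K κ * ω') :
    restrict (isoTangent K a) ω = restrict (isoTangent K a) ω' := by
  -- Both forms are replaced by pull-backs of their restrictions. Such pull-backs are killed by
  -- contraction with the columns of `dualMatrix`, which are dual to the perimeters.
  rw [← o.perimeterForm_mul_map hK ha, ← o.perimeterForm_mul_map hK ha κ ω', ← sub_eq_zero,
    ← mul_sub, ← map_sub, perimeterForm_eq] at h
  have hA : ∀ k k', perimeter K k' (o.dualMatrix hK *ᵥ Pi.single k 1) = if k = k' then 1 else 0 := by
    intro k k'
    rw [o.perimeter_apply hK, Matrix.mulVec_mulVec, o.incidence_mul_dualMatrix hK,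
      Matrix.one_mulVec, Pi.single_apply]
    simp only [eq_comm]
  have h1 := eq_zero_of_prod_mul_eq_zero (perimeter K)
    (fun k => Module.Dual.eval ℝ (Edge K → ℝ) (o.dualMatrix hK *ᵥ Pi.single k 1))
    (List.nodup_ofFn.2 κ.injective) (fun k => (hA k k).trans (if_pos rfl))
    (fun k k' hk => (hA k k').trans (if_neg hk))
    (fun k => contract_map_eq_zero _ _ (fun f => by
      rw [Module.Dual.eval_apply, LinearMap.dualMap_apply, o.isoProj_dualMatrix hK ha, map_zero]) _)
    h
  have h2 := o.restrict_comp_isoProj hK ha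
    (restrict (isoTangent K a) ω - restrict (isoTangent K a) ω')
  rw [h1, map_zero] at h2
  exact sub_eq_zero.1 h2.symm

/-! ### The Kontsevich form -/

/-- The bilinear form of the restriction of `Ω`. -/
def omegaBilin {o : Orientation K} (a : ℝ) (w : SideLabelling o) :
    isoTangent K a →ₗ[ℝ] isoTangent K a →ₗ[ℝ] ℝ :=
  ∑ k, ∑ β ∈ Finset.range (q K k - 1), ∑ α ∈ Finset.range (β + 1),
    wedge ((isoTangent K a).subtype.dualMap (length K (w.side k α)))
      ((isoTangent K a).subtype.dualMap (length K (w.side k β)))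

theorem restrict_Omega (hK : IsClosedSurface K) (ha : 0 < a) (w : SideLabelling o) :
    restrict (isoTangent K a) (Omega a w) = twoForm (omegaBilin a w) := by
  rw [Omega, omegaBilin, map_sum, map_sum]
  refine Finset.sum_congr rfl fun k _ => ?_
  have hq : (0 : ℝ) < q K k := Nat.cast_pos.2 (o.q_pos hK k)
  have hc : (√3 / 3 * a * q K k) ^ 2 * ((a * (√3 / 3) * q K k) ^ 2)⁻¹ = 1 := by
    rw [mul_comm a]
    exact mul_inv_cancel₀ (by positivity)
  rw [varpi, smul_smul, hc, one_smul, map_sum, map_sum]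
  refine Finset.sum_congr rfl fun β _ => ?_
  rw [map_sum, map_sum]
  refine Finset.sum_congr rfl fun α _ => ?_
  rw [twoForm_wedge, map_mul, restrict_d, restrict_d]
  rfl

theorem omegaBilin_self (w : SideLabelling o) (x : isoTangent K a) : omegaBilin a w x x = 0 := by
  rw [omegaBilin]
  simp only [LinearMap.sum_apply, wedge_apply]
  refine Finset.sum_eq_zero fun k _ => Finset.sum_eq_zero fun β _ => Finset.sum_eq_zero fun α _ => ?_
  ring

theorem omegaBilin_bivector (ha : 0 < a) (w : SideLabelling o) (x y : isoTangent K a)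
    {z : Edge K → ℝ} (hz : (o.dartMap hK).bivector *ᵥ z = y) :
    omegaBilin a w y x = 4 * (z ⬝ᵥ (x : Edge K → ℝ)) := by
  have hne : ∀ k i, k ≠ w.w k i ∧ {k, w.w k i} ∈ K.faces := fun k i =>
    ⟨(o.pos_ne (w.pos_succ k i)).1, pair_mem_faces (o.triangle_of_pos (w.pos_succ k i))⟩
  rw [← (o.dartMap hK).bivector_pairing (δ := fun k i => ⟨(k, w.w k i), hne k i⟩)
    (fun _ _ => rfl) (fun k i => o.nextDart_flipDart_of_pos hK (w.pos_succ k i) (hne k i)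
      (hne k (i + 1))) ((o.mem_isoTangent_iff_incidence hK ha _).1 x.2) z hz]
  simp only [omegaBilin, LinearMap.sum_apply, wedge_apply, o.card_star hK]
  refine Finset.sum_congr rfl fun k _ => Finset.sum_congr rfl fun β _ =>
    Finset.sum_congr rfl fun α _ => congrArg₂ _ rfl (mul_comm _ _)

/-- Rotate counterclockwise from the base darts. One labelling is needed to fix the reference
numbering of edges before an arbitrary labelling is given. -/
theorem exists_sideLabelling (hK : IsClosedSurface K) : Nonempty (SideLabelling o) := by
  set m := o.dartMap hK with hm
  let δ : V → ℕ → Dart K := fun k i => (m.rot⁻¹ ^ i) (m.base k)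
  have hr : ∀ k i, m.rot (δ k (i + 1)) = δ k i := by
    intro k i
    change m.rot ((m.rot⁻¹ ^ (i + 1)) (m.base k)) = _
    rw [pow_succ', Equiv.Perm.mul_apply, Equiv.Perm.inv_def, Equiv.apply_symm_apply]
    rfl
  have ht : ∀ k i, (δ k i).1.1 = k := by
    intro k i
    induction i with
    | zero => exact m.tail_base k
    | succ i ih =>
      rw [← hr k i] at ih
      exact ih
  refine ⟨⟨fun k i => (δ k i).1.2, fun k i => ?_⟩⟩
  have h1 := o.pos_apex hK (flipDart (δ k (i + 1)))
  have h2 : (δ k i).1.2 = o.apex hK (flipDart (δ k (i + 1))) := by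
    rw [← hr]
    rfl
  rw [← h2] at h1
  have h3 := o.rotate h1
  rw [show (flipDart (δ k (i + 1))).1.2 = k from ht k (i + 1)] at h3
  exact h3

theorem exists_bivector_eq (ha : 0 < a) (y : isoTangent K a) :
    ∃ z, (o.dartMap hK).bivector *ᵥ z = (y : Edge K → ℝ) :=
  (o.dartMap hK).exists_bivector_mulVec ((o.mem_isoTangent_iff_incidence hK ha _).1 y.2)

/-- The restriction of `Ω` does not depend on the starting sides. -/
theorem omegaBilin_eq (hK : IsClosedSurface K) (ha : 0 < a) (w w' : SideLabelling o) :
    omegaBilin a w = omegaBilin a w' := by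
  ext y x
  obtain ⟨z, hz⟩ := o.exists_bivector_eq hK ha y
  rw [o.omegaBilin_bivector hK ha w x y hz, o.omegaBilin_bivector hK ha w' x y hz]

/-- Write `x = B z`. If `Ω(x, ·) = 0` then `z` is orthogonal to the tangent space, hence to the
image of `B`; by antisymmetry `B z` is orthogonal to everything, itself included. -/
theorem omegaBilin_nondegenerate (hK : IsClosedSurface K) (ha : 0 < a) (w : SideLabelling o)
    (x : isoTangent K a) (hx : ∀ y, omegaBilin a w x y = 0) : x = 0 := by
  obtain ⟨z, hz⟩ := o.exists_bivector_eq hK ha x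
  have h1 : ∀ y : isoTangent K a, z ⬝ᵥ (y : Edge K → ℝ) = 0 := by
    intro y
    have h := o.omegaBilin_bivector hK ha w y x hz
    rw [hx] at h
    linarith
  have h2 : ∀ v, ((o.dartMap hK).bivector *ᵥ z) ⬝ᵥ v = 0 := by
    intro v
    have hmem : (o.dartMap hK).bivector *ᵥ v ∈ isoTangent K a := by
      rw [o.mem_isoTangent_iff_incidence hK ha, Matrix.mulVec_mulVec,
        (o.dartMap hK).incidence_mul_bivector, Matrix.zero_mulVec]
    have h3 := h1 ⟨_, hmem⟩
    rw [Matrix.dotProduct_mulVec, ← Matrix.mulVec_transpose, (o.dartMap hK).transpose_bivector,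
      Matrix.neg_mulVec, neg_dotProduct, neg_eq_zero] at h3
    exact h3
  rw [hz] at h2
  exact Subtype.ext (dotProduct_self_eq_zero.1 (h2 _))

end Orientation

/-! ### Determinants, renumberings and the Euler count. -/

open scoped Kronecker in
theorem det_symplectic {k : ℕ} (M : Matrix (Fin k × Fin 2) (Fin k × Fin 2) ℝ)
    (h : ∀ i s j t, M (i, s) (j, t) = if i = j then !![0, 1; -1, 0] s t else 0) : M.det = 1 := by
  have hM : M = (1 : Matrix (Fin k) (Fin k) ℝ) ⊗ₖ !![0, 1; -1, 0] := by
    ext ⟨i, s⟩ ⟨j, t⟩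
    rw [h, Matrix.kronecker_apply, Matrix.one_apply, ite_mul, one_mul, zero_mul]
  rw [hM, Matrix.det_kronecker, Matrix.det_one, Matrix.det_fin_two_of]
  norm_num

namespace DartMap

variable {D V E F : Type*} [Fintype D] [DecidableEq D] [Fintype V] [DecidableEq V]
  [Fintype E] [DecidableEq E] [Fintype F] [DecidableEq F] (m : DartMap D V E F)

theorem bivector_mul_transpose_incidence : m.bivector * m.incidenceᵀ = 0 := by
  have h := congrArg Matrix.transpose m.incidence_mul_bivector
  rw [Matrix.transpose_mul, m.transpose_bivector, Matrix.neg_mul, Matrix.transpose_zero,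
    neg_eq_zero] at h
  exact h

/-- Congruence of `B + Aᵀ A` by the stacked matrix is block diagonal, because `A B = 0` and `C Aᵀ =
0`. The bijections only make the stacked matrix square. -/
theorem det_fromRows_sq {J N : Type*} [Fintype J] [DecidableEq J] [Fintype N] [DecidableEq N]
    (C : Matrix J E ℝ) (hC : C * m.incidenceᵀ = 0) (e : N ≃ V ⊕ J) (ε : N ≃ E) :
    ((fromRows m.incidence C).submatrix e ε).det ^ 2 *
        (m.bivector + m.incidenceᵀ * m.incidence).det =
      (m.incidence * m.incidenceᵀ).det ^ 2 * (C * m.bivector * Cᵀ).det := by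
  have hC' : m.incidence * Cᵀ = 0 := by
    have h := congrArg Matrix.transpose hC
    rwa [Matrix.transpose_mul, Matrix.transpose_transpose, Matrix.transpose_zero] at h
  have h1 : fromRows m.incidence C * (m.bivector + m.incidenceᵀ * m.incidence) *
      (fromRows m.incidence C)ᵀ = fromBlocks
        (m.incidence * m.incidenceᵀ * (m.incidence * m.incidenceᵀ)) 0 0
        (C * m.bivector * Cᵀ) := by
    rw [Matrix.transpose_fromRows, Matrix.fromRows_mul, Matrix.fromRows_mul_fromCols,
      Matrix.mul_add, Matrix.mul_add, m.incidence_mul_bivector, ← Matrix.mul_assoc C, hC,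
      Matrix.zero_mul, zero_add, add_zero, Matrix.mul_assoc C, m.bivector_mul_transpose_incidence,
      Matrix.mul_zero]
    simp only [Matrix.mul_assoc, hC', Matrix.mul_zero]
  have h2 := congrArg (fun M => (M.submatrix e e).det) h1
  rw [← Matrix.submatrix_mul_equiv _ _ e ε e, ← Matrix.submatrix_mul_equiv _ _ e ε ε,
    Matrix.det_mul, Matrix.det_mul, ← Matrix.transpose_submatrix, Matrix.det_transpose,
    Matrix.det_submatrix_equiv_self, Matrix.det_submatrix_equiv_self,
    Matrix.det_fromBlocks_zero₂₁, Matrix.det_mul (m.incidence * m.incidenceᵀ)] at h2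
  linear_combination h2

end DartMap

theorem prod_d_eq_det_smul {N : ℕ} (u : Fin N → Module.Dual ℝ (Edge K → ℝ)) (ε : Fin N ≃ Edge K) :
    (List.ofFn fun i => d (u i)).prod =
      (Matrix.of fun i j => u i (Pi.single (ε j) 1)).det •
        (List.ofFn fun i => d (length K (ε i))).prod := by
  refine AlternatingMap.map_eq_det_smul (ExteriorAlgebra.ιMulti ℝ N) u _ _ fun i => ?_
  refine LinearMap.ext fun x => ?_
  rw [LinearMap.sum_apply]
  simp only [LinearMap.smul_apply, Matrix.of_apply, smul_eq_mul]
  rw [ε.sum_comp (fun e => u i (Pi.single e 1) * length K e x)]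
  conv_lhs => rw [LinearMap.pi_apply_eq_sum_univ (u i) x]
  refine Finset.sum_congr rfl fun e _ => ?_
  rw [smul_eq_mul, mul_comm]
  congr 2
  ext j
  simp [Pi.single_apply, eq_comm]

theorem reggeForm_eq_sign_smul (ε ε₀ : Fin (Fintype.card (Edge K)) ≃ Edge K) :
    reggeForm K ε = (((Equiv.Perm.sign (ε.trans ε₀.symm) : ℤ) : ℝ)) • reggeForm K ε₀ := by
  have h := AlternatingMap.map_perm (ExteriorAlgebra.ιMulti ℝ (Fintype.card (Edge K)))
    (fun i => length K (ε₀ i)) (ε.trans ε₀.symm)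
  have h1 : (fun i => length K (ε₀ i)) ∘ (ε.trans ε₀.symm) = fun i => length K (ε i) := by
    ext1 i
    simp
  rw [h1] at h
  refine h.trans ?_
  rw [Units.smul_def, Int.cast_smul_eq_zsmul]
  rfl

/-- The two members of each symplectic pair are placed next to each other, so the product regroups
into two-forms. -/
theorem ofFn_sum_prod {A : Type*} [Monoid A] {n k : ℕ} {I : Type*} (κ : Fin n ≃ I)
    (u : I ⊕ (Fin k × Fin 2) → A) :
    (List.ofFn fun i => u ((finSumFinEquiv.symm.trans
      (κ.sumCongr (finProdFinEquiv (m := k) (n := 2)).symm)) i)).prod =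
      (List.ofFn fun i => u (Sum.inl (κ i))).prod *
        (List.ofFn fun i => u (Sum.inr (i, 0)) * u (Sum.inr (i, 1))).prod := by
  have h : (fun i => u ((finSumFinEquiv.symm.trans
      (κ.sumCongr (finProdFinEquiv (m := k) (n := 2)).symm)) i)) =
      Fin.append (fun i => u (Sum.inl (κ i))) (fun i => u (Sum.inr (finProdFinEquiv.symm i))) := by
    ext i
    refine Fin.addCases (fun i => ?_) (fun i => ?_) i
    · simp
    · rw [Fin.append_right]
      simp only [Equiv.trans_apply, finSumFinEquiv_symm_apply_natAdd]
      rfl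
  rw [h, List.ofFn_fin_append, List.prod_append, List.ofFn_mul, List.prod_flatten, List.map_ofFn]
  congr 3
  ext i
  have hij : ∀ (j : Fin 2) (hlt : (i : ℕ) * 2 + j < k * 2),
      finProdFinEquiv.symm (⟨(i : ℕ) * 2 + j, hlt⟩ : Fin (k * 2)) = (i, j) := by
    intro j hlt
    rw [Equiv.symm_apply_eq]
    apply Fin.ext
    simp only [finProdFinEquiv_apply_val]
    ring
  simp only [Function.comp, List.ofFn_succ, List.ofFn_zero, List.prod_cons, List.prod_nil, mul_one]
  congr 2
  · exact congrArg Sum.inr (hij 0 _)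
  · exact congrArg Sum.inr (hij 1 _)

/-- Counting darts by edges and by triangles gives `2 N₁ = 3 N₂`. The final inequality, from `N₁ >
0`, ensures that the natural-number subtractions in the exponents are not truncated. -/
theorem euler_count (o : Orientation K) (hK : IsClosedSurface K) {g : ℕ} (hg : HasGenus K g) :
    Fintype.card (Edge K) + 6 = 3 * Fintype.card V + 6 * g ∧
      (triangles K).ncard + 4 = 2 * Fintype.card V + 4 * g ∧ 3 ≤ Fintype.card V + 2 * g := by
  have h1 := (o.dartMap hK).card_dart_eq_two_mul
  have h2 := (o.dartMap hK).card_dart_eq_three_mul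
  have h3 : (triangles K).ncard = Fintype.card (triangles K) := by
    rw [Set.ncard_eq_toFinset_card', Set.toFinset_card]
  have h4 : 2 * Fintype.card (Edge K) = 3 * Fintype.card (triangles K) := by
    have : (2 * Fintype.card (Edge K) : ℝ) = 3 * Fintype.card (triangles K) := by rw [← h1, h2]
    exact_mod_cast this
  have h5 : 0 < Fintype.card (Edge K) := by
    obtain ⟨v⟩ := hK.nonempty
    exact Fintype.card_pos_iff.2 ⟨Orientation.dartEdge ((o.dartMap hK).base v)⟩
  rw [HasGenus] at hg
  omega

/-! ### The symplectic coframe and the top power of the form. -/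

namespace Orientation

variable (o : Orientation K) (hK : IsClosedSurface K) {a : ℝ} (ha : 0 < a)

/-- The coefficient matrix of a symplectic coframe of `Ω`, extended by the orthogonal projection. -/
def coframe (b : isoTangent K a →ₗ[ℝ] isoTangent K a →ₗ[ℝ] ℝ) {J : Type*}
    (v : J → isoTangent K a) : Matrix J (Edge K) ℝ :=
  Matrix.of fun i j => b (v i) (o.isoProj hK ha (Pi.single j 1))

theorem coframe_mulVec (b : isoTangent K a →ₗ[ℝ] isoTangent K a →ₗ[ℝ] ℝ) {J : Type*}
    (v : J → isoTangent K a) (x : Edge K → ℝ) (i : J) :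
    (o.coframe hK ha b v *ᵥ x) i = b (v i) (o.isoProj hK ha x) := by
  have h := LinearMap.pi_apply_eq_sum_univ ((b (v i)).comp (o.isoProj hK ha)) x
  refine Eq.trans ?_ h.symm
  simp only [Matrix.mulVec, dotProduct, coframe, Matrix.of_apply, LinearMap.comp_apply, smul_eq_mul]
  refine Finset.sum_congr rfl fun e _ => ?_
  rw [mul_comm]
  congr 4
  ext j
  simp [Pi.single_apply, eq_comm]

theorem coframe_mul_transpose_incidence (b : isoTangent K a →ₗ[ℝ] isoTangent K a →ₗ[ℝ] ℝ)
    {J : Type*} (v : J → isoTangent K a) :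
    o.coframe hK ha b v * (o.dartMap hK).incidenceᵀ = 0 := by
  ext i k
  have h := o.coframe_mulVec hK ha b v ((o.dartMap hK).incidenceᵀ *ᵥ Pi.single k 1) i
  rw [o.isoProj_transpose, map_zero, Matrix.mulVec_mulVec, Matrix.mulVec_single_one] at h
  exact h

/-- Rows of `C` are the functionals `Ω(v i, ·)`, and `B` is four times the inverse of `Ω` on the
tangent space, so the inverse cancels one of the two copies of `Ω`. -/
theorem coframe_mul_bivector_mul (w : SideLabelling o) {J : Type*} [Fintype J] [DecidableEq J]
    (v : J → isoTangent K a) :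
    o.coframe hK ha (omegaBilin a w) v * (o.dartMap hK).bivector *
      (o.coframe hK ha (omegaBilin a w) v)ᵀ =
        (4 : ℝ) • Matrix.of fun i j => omegaBilin a w (v i) (v j) := by
  have hskew : ∀ x y, omegaBilin a w y x = -omegaBilin a w x y :=
    fun x y => (LinearMap.IsAlt.neg (o.omegaBilin_self w) x y).symm
  ext i j
  set C := o.coframe hK ha (omegaBilin a w) v with hC
  have hmem : (o.dartMap hK).bivector *ᵥ (Cᵀ *ᵥ Pi.single j 1) ∈ isoTangent K a := by
    rw [o.mem_isoTangent_iff_incidence hK ha, Matrix.mulVec_mulVec,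
      (o.dartMap hK).incidence_mul_bivector, Matrix.zero_mulVec]
  have h1 := o.coframe_mulVec hK ha (omegaBilin a w) v
    ((o.dartMap hK).bivector *ᵥ (Cᵀ *ᵥ Pi.single j 1)) i
  have h2 := o.isoProj_coe hK ha ⟨_, hmem⟩
  have h3 := o.omegaBilin_bivector hK ha w (v i) ⟨_, hmem⟩ rfl
  have h4 := o.coframe_mulVec hK ha (omegaBilin a w) v (v i) j
  rw [h2, hskew, h3, dotProduct_comm, Matrix.dotProduct_mulVec, Matrix.vecMul_transpose,
    dotProduct_single_one, ← hC, Matrix.mulVec_mulVec, Matrix.mulVec_mulVec,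
    Matrix.mulVec_single_one] at h1
  rw [h4, o.isoProj_coe hK ha, hskew] at h1
  refine h1.trans ?_
  rw [Matrix.smul_apply, Matrix.of_apply, smul_eq_mul]
  ring

/-- The top power of `Ω`, lifted to the space of all lengths and completed by the perimeter form, is
a multiple of the Regge form. -/
theorem exists_lift_pow (hK : IsClosedSurface K) (ha : 0 < a) {g : ℕ} (hg : HasGenus K g)
    (κ : Fin (Fintype.card V) ≃ V) (w : SideLabelling o) :
    ∃ ε₀ : Fin (Fintype.card (Edge K)) ≃ Edge K, ∃ ω : Form (Edge K → ℝ),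
      perimeterForm K κ * ω = (2 ^ (2 * Fintype.card V + 5 * g - 5) : ℝ) • reggeForm K ε₀ ∧
      restrict (isoTangent K a) ω = (((3 * g + Fintype.card V - 3).factorial : ℝ)⁻¹) •
        twoForm (omegaBilin a w) ^ (3 * g + Fintype.card V - 3) := by
  obtain ⟨hE, hF, hN⟩ := euler_count o hK hg
  have hdim := o.finrank_isoTangent_add hK ha
  have hskew : ∀ x y, omegaBilin a w y x = -omegaBilin a w x y :=
    fun x y => (LinearMap.IsAlt.neg (o.omegaBilin_self w) x y).symm
  obtain ⟨k, e, f, hef, hee, hff, hz⟩ := exists_symplectic_basis _ rfl (omegaBilin a w)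
    (o.omegaBilin_self w) (o.omegaBilin_nondegenerate hK ha w)
  have hk := finrank_eq_of_symplectic_basis hskew hef hee hff hz
  have hkd : 3 * g + Fintype.card V - 3 = k := by omega
  have hcard : Fintype.card V + k * 2 = Fintype.card (Edge K) := by omega
  rw [hkd]
  set b := omegaBilin a w with hb
  let v : Fin k × Fin 2 → isoTangent K a := fun p => ![e p.1, f p.1] p.2
  let u : V ⊕ (Fin k × Fin 2) → Module.Dual ℝ (Edge K → ℝ) :=
    Sum.elim (perimeter K) fun p => (o.isoProj hK ha).dualMap (b (v p))
  let Φ : Fin (Fintype.card (Edge K)) ≃ V ⊕ (Fin k × Fin 2) :=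
    (finCongr hcard.symm).trans (finSumFinEquiv.symm.trans (κ.sumCongr finProdFinEquiv.symm))
  let ω : Form (Edge K → ℝ) :=
    (List.ofFn fun i => d (u (Sum.inr (i, 0))) * d (u (Sum.inr (i, 1)))).prod
  have hprod : perimeterForm K κ * ω = (List.ofFn fun i => d (u (Φ i))).prod := by
    rw [List.ofFn_congr hcard.symm]
    exact (ofFn_sum_prod κ fun i => d (u i)).symm
  have hres : restrict (isoTangent K a) ω = ((k.factorial : ℝ)⁻¹) • twoForm b ^ k := by
    have hd : ∀ p, (isoTangent K a).subtype.dualMap (u (Sum.inr p)) = b (v p) := by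
      intro p
      refine LinearMap.ext fun x => ?_
      change b (v p) (o.isoProj hK ha x) = _
      rw [o.isoProj_coe hK ha]
    have h1 : restrict (isoTangent K a) ω = (List.ofFn fun i => d (b (e i)) * d (b (f i))).prod := by
      rw [map_list_prod, List.map_ofFn]
      congr 2
      ext1 i
      simp only [Function.comp, map_mul, restrict_d, hd]
      rfl
    have h2 : twoForm b = ∑ i, d (b (e i)) * d (b (f i)) := by
      conv_lhs => rw [eq_sum_wedge hskew hz, map_sum]
      exact Finset.sum_congr rfl fun i _ => twoForm_wedge _ _
    rw [h1, h2, (sum_pow_of_commute k (fun i => d (b (e i)) * d (b (f i)))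
      (fun i j => ι_mul_ι_commute _ _ _ _) fun i => ι_mul_ι_mul_self _ _).2, ← nsmul_eq_mul, ← Nat.cast_smul_eq_nsmul ℝ, smul_smul,
      inv_mul_cancel₀ (Nat.cast_ne_zero.2 k.factorial_ne_zero), one_smul]
  -- Only the square of the determinant is computed, which is why its sign stays undetermined here.
  have hdet : ∀ ε : Fin (Fintype.card (Edge K)) ≃ Edge K,
      |(Matrix.of fun i j => u (Φ i) (Pi.single (ε j) 1)).det| =
        2 ^ (2 * Fintype.card V + 5 * g - 5) := by
    intro ε
    set C := o.coframe hK ha b v with hC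
    have hX : (Matrix.of fun i j => u (Φ i) (Pi.single (ε j) 1)) =
        (fromRows (o.dartMap hK).incidence C).submatrix Φ ε := by
      ext i j
      rw [Matrix.of_apply, Matrix.submatrix_apply]
      rcases Φ i with p | p
      · change perimeter K p _ = (o.dartMap hK).incidence p (ε j)
        rw [o.perimeter_apply hK, Matrix.mulVec_single_one, Matrix.col_apply]
      · rfl
    have h1 := (o.dartMap hK).det_fromRows_sq C (o.coframe_mul_transpose_incidence hK ha b v) Φ ε
    have h2 := (o.dartMap hK).abs_det_bivector_add
    have h3 := (o.dartMap hK).det_incidence_mul_transpose_ne_zero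
    have h4 : (Matrix.of fun i j => b (v i) (v j)).det = 1 := by
      refine det_symplectic _ fun i s j t => ?_
      change b (![e i, f i] s) (![e j, f j] t) = _
      fin_cases s <;> fin_cases t
      · simpa using hee i j
      · simpa using hef i j
      · change b (f i) (e j) = if i = j then (-1 : ℝ) else 0
        rw [hskew (e j), hef]
        by_cases hij : i = j
        · simp [hij]
        · simp [hij, Ne.symm hij]
      · simpa using hff i j
    rw [hC, o.coframe_mul_bivector_mul hK ha w v, Matrix.det_smul, h4, mul_one, Fintype.card_prod,
      Fintype.card_fin, Fintype.card_fin, ← hC, ← hX] at h1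
    set X := (Matrix.of fun i j => u (Φ i) (Pi.single (ε j) 1)).det
    set Q := ((o.dartMap hK).incidence * (o.dartMap hK).incidenceᵀ).det
    set S := ((o.dartMap hK).bivector +
      (o.dartMap hK).incidenceᵀ * (o.dartMap hK).incidence).det
    have h5 := congrArg abs h1
    rw [abs_mul, abs_mul, abs_of_nonneg (sq_nonneg X), abs_of_nonneg (sq_nonneg Q),
      abs_of_nonneg (by positivity : (0 : ℝ) ≤ 4 ^ (k * 2))] at h5
    have h6 : (triangles K).ncard = Fintype.card (triangles K) := by
      rw [Set.ncard_eq_toFinset_card', Set.toFinset_card]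
    set M := 2 * Fintype.card V + 5 * g - 5 with hM
    have h7 : X ^ 2 * 2 ^ Fintype.card (Edge K) * Q ^ 2 =
        2 ^ (Fintype.card (triangles K) + Fintype.card V) * 4 ^ (k * 2) * Q ^ 2 := by
      linear_combination 2 ^ (Fintype.card (triangles K) + Fintype.card V) * h5 - X ^ 2 * h2
    have h8 := mul_right_cancel₀ (pow_ne_zero 2 h3) h7
    -- The Euler relations give `N₂ + N₀ + 4 k = 2 M + N₁`, where `2 k = N₁ - N₀`.
    have h9 : (2 : ℝ) ^ (Fintype.card (triangles K) + Fintype.card V) * 4 ^ (k * 2) =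
        (2 ^ M) ^ 2 * 2 ^ Fintype.card (Edge K) := by
      rw [show (4 : ℝ) = 2 ^ 2 by norm_num, ← pow_mul, ← pow_mul, ← pow_add, ← pow_add]
      congr 1
      omega
    rw [h9] at h8
    have h10 := mul_right_cancel₀ (by positivity) h8
    rw [← abs_of_pos (by positivity : (0 : ℝ) < 2 ^ M)]
    exact (sq_eq_sq_iff_abs_eq_abs _ _).1 h10
  have hreg : ∀ ε : Fin (Fintype.card (Edge K)) ≃ Edge K, perimeterForm K κ * ω =
      (Matrix.of fun i j => u (Φ i) (Pi.single (ε j) 1)).det • reggeForm K ε := by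
    intro ε
    rw [hprod, prod_d_eq_det_smul _ ε]
    rfl
  let ε₁ : Fin (Fintype.card (Edge K)) ≃ Edge K := (Fintype.equivFin (Edge K)).symm
  have h1 := hreg ε₁
  rcases abs_choice (Matrix.of fun i j => u (Φ i) (Pi.single (ε₁ j) 1)).det with h | h
  · rw [← h, hdet] at h1
    exact ⟨ε₁, ω, h1, hres⟩
  -- A negative determinant is corrected by swapping the first two edges.
  · have hN2 : 2 ≤ Fintype.card (Edge K) := by omega
    let τ : Equiv.Perm (Fin (Fintype.card (Edge K))) := Equiv.swap ⟨0, by omega⟩ ⟨1, by omega⟩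
    refine ⟨τ.trans ε₁, ω, ?_, hres⟩
    have hsign : Equiv.Perm.sign ((τ.trans ε₁).trans ε₁.symm) = -1 := by
      rw [Equiv.trans_assoc, Equiv.self_trans_symm, Equiv.trans_refl]
      exact Equiv.Perm.sign_swap (by simp)
    rw [reggeForm_eq_sign_smul (τ.trans ε₁) ε₁, hsign, h1, ← hdet ε₁, h, smul_smul]
    simp

end Orientation

end Regge

theorem lemma9 {V : Type*} [Fintype V] [DecidableEq V] (K : AbstractSimplicialComplex V)
    (hK : Regge.IsClosedSurface K) (o : Regge.Orientation K) (g : ℕ) (hg : Regge.HasGenus K g)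
    (a : ℝ) (ha : 0 < a) (κ : Fin (Fintype.card V) ≃ V) :
    Module.finrank ℝ (Regge.isoTangent K a) = 2 * (3 * g + Fintype.card V - 3) ∧
    (∀ ε : Fin (Fintype.card (Regge.Edge K)) ≃ Regge.Edge K,
      ∃! v, Regge.IsReggeRestriction K a κ ε v) ∧
    ∃ ε₀ : Fin (Fintype.card (Regge.Edge K)) ≃ Regge.Edge K,
      ∀ (w : Regge.SideLabelling o) (ε : Fin (Fintype.card (Regge.Edge K)) ≃ Regge.Edge K)
        (v : Regge.Form (Regge.isoTangent K a)), Regge.IsReggeRestriction K a κ ε v →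
        (((3 * g + Fintype.card V - 3).factorial : ℝ)⁻¹) •
            (Regge.restrict (Regge.isoTangent K a) (Regge.Omega a w)) ^
              (3 * g + Fintype.card V - 3) =
          (((Equiv.Perm.sign (ε.trans ε₀.symm) : ℤ) : ℝ) *
            2 ^ (2 * Fintype.card V + 5 * g - 5)) • v := by
  obtain ⟨w₀⟩ := o.exists_sideLabelling hK
  obtain ⟨ε₀, ω₀, hω₀, hres⟩ := o.exists_lift_pow hK ha hg κ w₀
  have hunique : ∀ {ω ω' : Regge.Form (Regge.Edge K → ℝ)},
      Regge.perimeterForm K κ * ω = Regge.perimeterForm K κ * ω' →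
      Regge.restrict (Regge.isoTangent K a) ω = Regge.restrict (Regge.isoTangent K a) ω' :=
    fun h => o.restrict_eq_of_perimeterForm_mul_eq hK ha κ h
  refine ⟨?_, fun ε => ?_, ε₀, fun w ε v hv => ?_⟩
  · have h1 := Regge.euler_count o hK hg
    have h2 := o.finrank_isoTangent_add hK ha
    omega
  -- The lift of the top power of `Ω`, divided by its constant and multiplied by the sign, already
  -- serves as the required `ω`.
  · refine existsUnique_of_exists_of_unique ⟨_, ((Equiv.Perm.sign (ε.trans ε₀.symm) : ℤ) : ℝ) •
      ((2 : ℝ) ^ (2 * Fintype.card V + 5 * g - 5))⁻¹ • ω₀, ?_, rfl⟩ ?_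
    · rw [mul_smul_comm, mul_smul_comm, hω₀, smul_smul _ _ (Regge.reggeForm K ε₀),
        inv_mul_cancel₀ (by positivity), one_smul, ← Regge.reggeForm_eq_sign_smul]
    · rintro v v' ⟨ω, hω, rfl⟩ ⟨ω', hω', rfl⟩
      exact hunique (hω.trans hω'.symm)
  · obtain ⟨ω, hω, rfl⟩ := hv
    rw [o.restrict_Omega hK ha w, o.omegaBilin_eq hK ha w w₀, ← hres, ← map_smul]
    -- The identity on the simplex is checked after multiplying lifts by the perimeter form, where
    -- both sides are multiples of one Regge form.
    refine hunique ?_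
    have hs : (((Equiv.Perm.sign (ε.trans ε₀.symm) : ℤ) : ℝ)) *
        ((Equiv.Perm.sign (ε.trans ε₀.symm) : ℤ) : ℝ) = 1 := by
      rcases Int.units_eq_one_or (Equiv.Perm.sign (ε.trans ε₀.symm)) with h | h <;> simp [h]
    rw [hω₀, mul_smul_comm, hω, Regge.reggeForm_eq_sign_smul ε ε₀, smul_smul, mul_right_comm, hs,
      one_mul]

end
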